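/- Let $d\in\{2,3\}$ and let $\Omega_1,\Omega_2\subset\mathbb R^d$ be bounded domains (non-empty, connected, open sets) of class $C^3$ with $\overline{\Omega_1}\subset\Omega_2$. Put $\Omega=\Omega_2\setminus\overline{\Omega_1}$, $\Gamma=\partial\Omega_1$, $\Gamma_0=\partial\Omega_2$, and assume that $\Omega$ is connected. Let $$H^1_\diamond(\Omega)=\{u\in H^1(\Omega):\ u|_{\Gamma_0}=0\}$$ in the sense of traces, with the norm $\|u\|_{H^1(\Omega)}=(\|u\|_{L^2(\Omega)}^2+\|\nabla u\|_{L^2(\Omega)}^2)^{1/2}$. Let $H^{1/2}(\Gamma)\subset L^2(\Gamma)$ be the space of traces on $\Gamma$ of functions in $H^1(\Omega)$, with the norm $\|t\|_{H^{1/2}(\Gamma)}=\inf\{\|w\|_{H^1(\Omega)}: w\in H^1(\Omega),\ w|_\Gamma=t\}$, and let $H^{-1/2}(\Gamma)$ be its dual space; $H^1(\Omega)'$ denotes the dual of $H^1(\Omega)$; both duals carry the dual norms. There is a constant $C>0$, depending only on $\Omega_1$ and $\Omega_2$, such that the following holds. Let $\beta\in C^3(\mathbb R)$ be non-decreasing with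 $\beta(0)=0$ and with $\beta',\beta'',\beta'''$ bounded, let $a\in L^\infty(\Gamma)$ satisfy $a\ge a_0$ almost everywhere on $\Gamma$ for some constant $a_0>0$, and let $f\in H^1(\Omega)'$ and $g\in H^{-1/2}(\Gamma)$. Then the weak form of the problem $\Delta u=f$ in $\Omega$, $\partial_\nu u+a\beta(u)=g$ on $\Gamma$, $u=0$ on $\Gamma_0$, that is $$\int_\Omega\nabla u\cdot\nabla v\,dx+\int_\Gamma a\,\beta(u)\,v\,ds=-\langle f,v\rangle+\langle g,v|_\Gamma\rangle\qquad\text{for all } v\in H^1_\diamond(\Omega),$$ has a unique solution $u\in H^1_\diamond(\Omega)$, and this solution satisfies $$\|u\|_{H^1(\Omega)}\le C\left(\|f\|_{H^1(\Omega)'}+\|g\|_{H^{-1/2}(\Gamma)}\right).$$ -/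

import Mathlib

open MeasureTheory Filter Topology
open scoped ENNReal ContDiff Gradient

noncomputable section

namespace RobinProblem

/-- Bounded, connected, open sets (domains) of class `C³`: near every boundary point, in suitable
orthonormal coordinates, the set is the strict epigraph of a `C³` function. The unit vector `ν` is
the direction of the graph, and `x - ⟪ν, x⟫ • ν` is the orthogonal projection of `x` onto `ν^⊥`. -/
structure IsBoundedC3Domain {d : ℕ} (U : Set (EuclideanSpace ℝ (Fin d))) : Prop where
  isOpen : IsOpen U
  isConnected : IsConnected U
  isBounded : Bornology.IsBounded U
  boundary : ∀ x₀ ∈ frontier U, ∃ r > 0, ∃ ν : EuclideanSpace ℝ (Fin d), ‖ν‖ = 1 ∧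
    ∃ γ : EuclideanSpace ℝ (Fin d) → ℝ, ContDiff ℝ 3 γ ∧
      ∀ x ∈ Metric.ball x₀ r, (x ∈ U ↔ γ (x - inner ℝ ν x • ν) < inner ℝ ν x)

/-- Surface measure on a subset `S` of a hypersurface: the `(d-1)`-dimensional Hausdorff measure,
normalized so that it agrees with Lebesgue measure on hyperplanes, restricted to `S`. -/
abbrev surfaceMeasure {d : ℕ} (S : Set (EuclideanSpace ℝ (Fin d))) :
    Measure (EuclideanSpace ℝ (Fin d)) :=
  (Measure.euclideanHausdorffMeasure (d - 1)).restrict S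

/-- `G` is the weak gradient of `u` in the open set `Ω`. -/
def IsWeakGradient {d : ℕ} (Ω : Set (EuclideanSpace ℝ (Fin d)))
    (u : EuclideanSpace ℝ (Fin d) → ℝ)
    (G : EuclideanSpace ℝ (Fin d) → EuclideanSpace ℝ (Fin d)) : Prop :=
  ∀ φ : EuclideanSpace ℝ (Fin d) → ℝ, ContDiff ℝ ∞ φ → HasCompactSupport φ → tsupport φ ⊆ Ω →
    ∫ x in Ω, u x • ∇ φ x = - ∫ x in Ω, φ x • G x

theorem continuous_gradient_of_contDiff {d : ℕ} {φ : EuclideanSpace ℝ (Fin d) → ℝ}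
    (h : ContDiff ℝ ∞ φ) : Continuous (fun x => ∇ φ x) :=
  (InnerProductSpace.toDual ℝ (EuclideanSpace ℝ (Fin d))).symm.continuous.comp
    (h.continuous_fderiv (by simp))

theorem hasCompactSupport_gradient {d : ℕ} {φ : EuclideanSpace ℝ (Fin d) → ℝ}
    (h : HasCompactSupport φ) : HasCompactSupport (fun x => ∇ φ x) :=
  (h.fderiv (𝕜 := ℝ)).comp_left
    (g := (InnerProductSpace.toDual ℝ (EuclideanSpace ℝ (Fin d))).symm) (by simp)

theorem integrable_smul_gradient {d : ℕ} {Ω : Set (EuclideanSpace ℝ (Fin d))}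
    (u : Lp ℝ 2 (volume.restrict Ω)) {φ : EuclideanSpace ℝ (Fin d) → ℝ}
    (h : ContDiff ℝ ∞ φ) (hc : HasCompactSupport φ) :
    Integrable (fun x => u x • ∇ φ x) (volume.restrict Ω) :=
  memLp_one_iff_integrable.1 <|
    (((continuous_gradient_of_contDiff h).memLp_of_hasCompactSupport
      (hasCompactSupport_gradient hc) : MemLp _ 2 volume).restrict Ω).smul (Lp.memLp u)

theorem integrable_smul_field {d : ℕ} {Ω : Set (EuclideanSpace ℝ (Fin d))}
    (G : Lp (EuclideanSpace ℝ (Fin d)) 2 (volume.restrict Ω))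
    {φ : EuclideanSpace ℝ (Fin d) → ℝ} (h : ContDiff ℝ ∞ φ) (hc : HasCompactSupport φ) :
    Integrable (fun x => φ x • G x) (volume.restrict Ω) :=
  memLp_one_iff_integrable.1 <|
    (Lp.memLp G).smul
      ((h.continuous.memLp_of_hasCompactSupport hc : MemLp _ 2 volume).restrict Ω)

/-- The Sobolev space `H¹(Ω)`: pairs `(u, ∇u)` of a function `u ∈ L²(Ω)` and its weak gradient
`∇u ∈ L²(Ω; ℝᵈ)`, with the Hilbert norm `(‖u‖² + ‖∇u‖²)^(1/2)` inherited from the `ℓ²`-product. -/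
def H1 {d : ℕ} (Ω : Set (EuclideanSpace ℝ (Fin d))) :
    Submodule ℝ (WithLp 2 (Lp ℝ 2 ((volume : Measure (EuclideanSpace ℝ (Fin d))).restrict Ω) ×
      Lp (EuclideanSpace ℝ (Fin d)) 2 (volume.restrict Ω))) where
  carrier := {w | IsWeakGradient Ω w.fst w.snd}
  zero_mem' := by
    intro φ _ _ _
    have h1 : (fun x => ((0 : Lp ℝ 2 ((volume : Measure (EuclideanSpace ℝ (Fin d))).restrict Ω))
        x) • ∇ φ x) =ᵐ[volume.restrict Ω] 0 := by
      filter_upwards [Lp.coeFn_zero ℝ 2 (volume.restrict Ω)] with x hx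
      rw [hx, Pi.zero_apply, Pi.zero_apply, zero_smul]
    have h2 : (fun x => φ x • ((0 : Lp (EuclideanSpace ℝ (Fin d)) 2 (volume.restrict Ω))
        x)) =ᵐ[volume.restrict Ω] 0 := by
      filter_upwards [Lp.coeFn_zero (EuclideanSpace ℝ (Fin d)) 2 (volume.restrict Ω)] with x hx
      simp only [hx, Pi.zero_apply, smul_zero]
    have e1 := integral_congr_ae h1
    have e2 := integral_congr_ae h2
    simp only [Pi.zero_apply, integral_zero] at e1 e2
    change ∫ x in Ω, ((0 : Lp ℝ 2 (volume.restrict Ω)) x) • ∇ φ x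
      = - ∫ x in Ω, φ x • ((0 : Lp (EuclideanSpace ℝ (Fin d)) 2 (volume.restrict Ω)) x)
    rw [e1, e2, neg_zero]
  add_mem' := by
    intro v w hv hw φ h1 h2 h3
    have e1 : ∫ x in Ω, (v.fst + w.fst : Lp ℝ 2 (volume.restrict Ω)) x • ∇ φ x
        = ∫ x in Ω, (v.fst x • ∇ φ x + w.fst x • ∇ φ x) := by
      apply integral_congr_ae
      filter_upwards [Lp.coeFn_add v.fst w.fst] with x hx
      rw [hx, Pi.add_apply, add_smul]
    have e2 : ∫ x in Ω, φ x • (v.snd + w.snd : Lp (EuclideanSpace ℝ (Fin d)) 2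
        (volume.restrict Ω)) x = ∫ x in Ω, (φ x • v.snd x + φ x • w.snd x) := by
      apply integral_congr_ae
      filter_upwards [Lp.coeFn_add v.snd w.snd] with x hx
      rw [hx, Pi.add_apply, smul_add]
    change ∫ x in Ω, (v.fst + w.fst : Lp ℝ 2 (volume.restrict Ω)) x • ∇ φ x
      = - ∫ x in Ω, φ x • (v.snd + w.snd : Lp (EuclideanSpace ℝ (Fin d)) 2
        (volume.restrict Ω)) x
    rw [e1, e2, integral_add (integrable_smul_gradient _ h1 h2)
      (integrable_smul_gradient _ h1 h2), integral_add (integrable_smul_field _ h1 h2)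
      (integrable_smul_field _ h1 h2), hv φ h1 h2 h3, hw φ h1 h2 h3]
    abel
  smul_mem' := by
    intro c v hv φ h1 h2 h3
    have e1 : ∫ x in Ω, (c • v.fst : Lp ℝ 2 (volume.restrict Ω)) x • ∇ φ x
        = ∫ x in Ω, c • (v.fst x • ∇ φ x) := by
      apply integral_congr_ae
      filter_upwards [Lp.coeFn_smul c v.fst] with x hx
      rw [hx, Pi.smul_apply, smul_assoc]
    have e2 : ∫ x in Ω, φ x • (c • v.snd : Lp (EuclideanSpace ℝ (Fin d)) 2
        (volume.restrict Ω)) x = ∫ x in Ω, c • (φ x • v.snd x) := by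
      apply integral_congr_ae
      filter_upwards [Lp.coeFn_smul c v.snd] with x hx
      rw [hx, Pi.smul_apply, smul_comm]
    change ∫ x in Ω, (c • v.fst : Lp ℝ 2 (volume.restrict Ω)) x • ∇ φ x
      = - ∫ x in Ω, φ x • (c • v.snd : Lp (EuclideanSpace ℝ (Fin d)) 2
        (volume.restrict Ω)) x
    rw [e1, e2, integral_smul, integral_smul, hv φ h1 h2 h3, smul_neg]

/-- The function underlying an element of `H¹(Ω)`. -/
abbrev toL2 {d : ℕ} {Ω : Set (EuclideanSpace ℝ (Fin d))} (u : H1 Ω) :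
    Lp ℝ 2 ((volume : Measure (EuclideanSpace ℝ (Fin d))).restrict Ω) :=
  (u : WithLp 2 (Lp ℝ 2 ((volume : Measure (EuclideanSpace ℝ (Fin d))).restrict Ω) ×
      Lp (EuclideanSpace ℝ (Fin d)) 2 (volume.restrict Ω))).fst

/-- The weak gradient of an element of `H¹(Ω)`. -/
abbrev weakGrad {d : ℕ} {Ω : Set (EuclideanSpace ℝ (Fin d))} (u : H1 Ω) :
    Lp (EuclideanSpace ℝ (Fin d)) 2 ((volume : Measure (EuclideanSpace ℝ (Fin d))).restrict Ω) :=
  (u : WithLp 2 (Lp ℝ 2 ((volume : Measure (EuclideanSpace ℝ (Fin d))).restrict Ω) ×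
      Lp (EuclideanSpace ℝ (Fin d)) 2 (volume.restrict Ω))).snd

/-- `t ∈ L²(S)` is the trace of `u ∈ H¹(Ω)` on the boundary portion `S ⊆ ∂Ω`: the trace operator is
the continuous extension of the restriction `φ ↦ φ|_S` of functions that are smooth up to the
boundary, i.e. there are `φₙ ∈ C_c^∞(ℝᵈ)` with `φₙ → u` in `H¹(Ω)` and `φₙ|_S → t` in `L²(S)`. -/
def HasTrace {d : ℕ} {Ω : Set (EuclideanSpace ℝ (Fin d))} (S : Set (EuclideanSpace ℝ (Fin d)))
    (u : H1 Ω) (t : Lp ℝ 2 (surfaceMeasure S)) : Prop :=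
  ∃ φ : ℕ → EuclideanSpace ℝ (Fin d) → ℝ,
    (∀ n, ContDiff ℝ ∞ (φ n) ∧ HasCompactSupport (φ n)) ∧
    Tendsto (fun n => eLpNorm (fun x => φ n x - toL2 u x) 2 (volume.restrict Ω)) atTop (𝓝 0) ∧
    Tendsto (fun n => eLpNorm (fun x => ∇ (φ n) x - weakGrad u x) 2 (volume.restrict Ω))
      atTop (𝓝 0) ∧
    Tendsto (fun n => eLpNorm (fun x => φ n x - t x) 2 (surfaceMeasure S)) atTop (𝓝 0)

theorem tendsto_eLpNorm_add {α F : Type*} [MeasurableSpace α] {μ : Measure α}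
    [NormedAddCommGroup F] {p q : ℕ → α → F} {P Q R : Lp F 2 μ} (hR : R = P + Q)
    (hp : ∀ n, AEStronglyMeasurable (p n) μ) (hq : ∀ n, AEStronglyMeasurable (q n) μ)
    (h1 : Tendsto (fun n => eLpNorm (fun x => p n x - P x) 2 μ) atTop (𝓝 0))
    (h2 : Tendsto (fun n => eLpNorm (fun x => q n x - Q x) 2 μ) atTop (𝓝 0))
    {r : ℕ → α → F} (hr : ∀ n x, r n x = p n x + q n x) :
    Tendsto (fun n => eLpNorm (fun x => r n x - R x) 2 μ) atTop (𝓝 0) := by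
  have h := h1.add h2
  rw [add_zero] at h
  refine tendsto_of_tendsto_of_tendsto_of_le_of_le tendsto_const_nhds h (fun _ => zero_le)
    (fun n => ?_)
  have e : (fun x => r n x - R x) =ᵐ[μ]
      (fun x => p n x - P x) + (fun x => q n x - Q x) := by
    filter_upwards [Lp.coeFn_add P Q] with x hx
    rw [hR, hx, hr]
    simp only [Pi.add_apply]
    abel
  change eLpNorm (fun x => r n x - R x) 2 μ ≤ _
  rw [eLpNorm_congr_ae e]
  exact eLpNorm_add_le ((hp n).sub (Lp.aestronglyMeasurable P))
    ((hq n).sub (Lp.aestronglyMeasurable Q)) (by norm_num)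

theorem tendsto_eLpNorm_smul {α F : Type*} [MeasurableSpace α] {μ : Measure α}
    [NormedAddCommGroup F] [NormedSpace ℝ F] {p : ℕ → α → F} {P R : Lp F 2 μ} {c : ℝ}
    (hR : R = c • P)
    (h1 : Tendsto (fun n => eLpNorm (fun x => p n x - P x) 2 μ) atTop (𝓝 0))
    {r : ℕ → α → F} (hr : ∀ n x, r n x = c • p n x) :
    Tendsto (fun n => eLpNorm (fun x => r n x - R x) 2 μ) atTop (𝓝 0) := by
  have h : Tendsto (fun n => ‖c‖ₑ * eLpNorm (fun x => p n x - P x) 2 μ) atTop (𝓝 (‖c‖ₑ * 0)) :=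
    ENNReal.Tendsto.const_mul h1 (Or.inr (by simp))
  rw [mul_zero] at h
  refine h.congr (fun n => ?_)
  have e : (fun x => r n x - R x) =ᵐ[μ] c • (fun x => p n x - P x) := by
    filter_upwards [Lp.coeFn_smul c P] with x hx
    rw [hR, hx, hr]
    simp only [Pi.smul_apply, smul_sub]
  rw [eLpNorm_congr_ae e, eLpNorm_const_smul]

theorem gradient_add_of_contDiff {d : ℕ} {φ ψ : EuclideanSpace ℝ (Fin d) → ℝ}
    (h : ContDiff ℝ ∞ φ) (k : ContDiff ℝ ∞ ψ) (x : EuclideanSpace ℝ (Fin d)) :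
    ∇ (fun y => φ y + ψ y) x = ∇ φ x + ∇ ψ x := by
  unfold gradient
  rw [fderiv_fun_add (h.differentiable (by simp) x) (k.differentiable (by simp) x), map_add]

theorem gradient_smul_of_contDiff {d : ℕ} {φ : EuclideanSpace ℝ (Fin d) → ℝ} (c : ℝ)
    (h : ContDiff ℝ ∞ φ) (x : EuclideanSpace ℝ (Fin d)) :
    ∇ (fun y => c • φ y) x = c • ∇ φ x := by
  unfold gradient
  rw [fderiv_fun_const_smul (h.differentiable (by simp) x)]
  simp

theorem HasTrace.zero {d : ℕ} {Ω : Set (EuclideanSpace ℝ (Fin d))}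
    (S : Set (EuclideanSpace ℝ (Fin d))) : HasTrace S (0 : H1 Ω) 0 := by
  refine ⟨fun _ _ => 0, fun _ => ⟨contDiff_const, HasCompactSupport.zero⟩, ?_, ?_, ?_⟩
  · refine tendsto_const_nhds.congr (fun n => (?_ : (0 : ℝ≥0∞) = _))
    rw [eq_comm, ← eLpNorm_zero (μ := volume.restrict Ω) (ε := ℝ) (p := 2)
      (α := EuclideanSpace ℝ (Fin d))]
    apply eLpNorm_congr_ae
    filter_upwards [Lp.coeFn_zero ℝ 2
      ((volume : Measure (EuclideanSpace ℝ (Fin d))).restrict Ω)] with x hx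
    change (0 : ℝ) - (0 : Lp ℝ 2 (volume.restrict Ω)) x = 0
    rw [hx]; simp
  · refine tendsto_const_nhds.congr (fun n => (?_ : (0 : ℝ≥0∞) = _))
    rw [eq_comm, ← eLpNorm_zero (μ := volume.restrict Ω) (ε := EuclideanSpace ℝ (Fin d)) (p := 2)
      (α := EuclideanSpace ℝ (Fin d))]
    apply eLpNorm_congr_ae
    filter_upwards [Lp.coeFn_zero (EuclideanSpace ℝ (Fin d)) 2
      ((volume : Measure (EuclideanSpace ℝ (Fin d))).restrict Ω)] with x hx
    change ∇ (fun _ => (0 : ℝ)) x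
      - (0 : Lp (EuclideanSpace ℝ (Fin d)) 2 (volume.restrict Ω)) x = 0
    rw [hx]; simp [gradient]
  · refine tendsto_const_nhds.congr (fun n => (?_ : (0 : ℝ≥0∞) = _))
    rw [eq_comm, ← eLpNorm_zero (μ := surfaceMeasure S) (ε := ℝ) (p := 2)
      (α := EuclideanSpace ℝ (Fin d))]
    apply eLpNorm_congr_ae
    filter_upwards [Lp.coeFn_zero ℝ 2 (surfaceMeasure S)] with x hx
    rw [hx]; simp

theorem HasTrace.add {d : ℕ} {Ω : Set (EuclideanSpace ℝ (Fin d))}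
    {S : Set (EuclideanSpace ℝ (Fin d))} {u v : H1 Ω} {s t : Lp ℝ 2 (surfaceMeasure S)}
    (hu : HasTrace S u s) (hv : HasTrace S v t) : HasTrace S (u + v) (s + t) := by
  obtain ⟨φ, hφ, a1, a2, a3⟩ := hu
  obtain ⟨ψ, hψ, b1, b2, b3⟩ := hv
  refine ⟨fun n x => φ n x + ψ n x,
    fun n => ⟨(hφ n).1.add (hψ n).1, (hφ n).2.add (hψ n).2⟩, ?_, ?_, ?_⟩
  · exact tendsto_eLpNorm_add rfl (fun n => (hφ n).1.continuous.aestronglyMeasurable)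
      (fun n => (hψ n).1.continuous.aestronglyMeasurable) a1 b1 (fun _ _ => rfl)
  · exact tendsto_eLpNorm_add rfl
      (fun n => (continuous_gradient_of_contDiff (hφ n).1).aestronglyMeasurable)
      (fun n => (continuous_gradient_of_contDiff (hψ n).1).aestronglyMeasurable) a2 b2
      (fun n x => gradient_add_of_contDiff (hφ n).1 (hψ n).1 x)
  · exact tendsto_eLpNorm_add rfl (fun n => (hφ n).1.continuous.aestronglyMeasurable)
      (fun n => (hψ n).1.continuous.aestronglyMeasurable) a3 b3 (fun _ _ => rfl)

theorem HasTrace.smul {d : ℕ} {Ω : Set (EuclideanSpace ℝ (Fin d))}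
    {S : Set (EuclideanSpace ℝ (Fin d))} {u : H1 Ω} {s : Lp ℝ 2 (surfaceMeasure S)} (c : ℝ)
    (hu : HasTrace S u s) : HasTrace S (c • u) (c • s) := by
  obtain ⟨φ, hφ, a1, a2, a3⟩ := hu
  refine ⟨fun n x => c • φ n x,
    fun n => ⟨(hφ n).1.const_smul c, (hφ n).2.smul_left (f := fun _ => c)⟩, ?_, ?_, ?_⟩
  · exact tendsto_eLpNorm_smul rfl a1 (fun _ _ => rfl)
  · exact tendsto_eLpNorm_smul rfl a2 (fun n x => gradient_smul_of_contDiff c (hφ n).1 x)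
  · exact tendsto_eLpNorm_smul rfl a3 (fun _ _ => rfl)

/-- The space `H¹_◇(Ω) = {u ∈ H¹(Ω) : u|_{Γ₀} = 0}`, with the norm of `H¹(Ω)`. -/
def H1Diamond {d : ℕ} (Ω Γ₀ : Set (EuclideanSpace ℝ (Fin d))) : Submodule ℝ (H1 Ω) where
  carrier := {u | HasTrace Γ₀ u 0}
  zero_mem' := HasTrace.zero Γ₀
  add_mem' := by
    intro u v hu hv
    have h : HasTrace Γ₀ (u + v) (0 + 0) := HasTrace.add hu hv
    rwa [add_zero] at h
  smul_mem' := by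
    intro c u hu
    have h : HasTrace Γ₀ (c • u) (c • 0) := HasTrace.smul c hu
    rwa [smul_zero] at h

/-- The set of traces on `Γ` of functions in `H¹(Ω)`, as a linear subspace of `L²(Γ)`. -/
def traces {d : ℕ} (Ω Γ : Set (EuclideanSpace ℝ (Fin d))) :
    Submodule ℝ (Lp ℝ 2 (surfaceMeasure Γ)) where
  carrier := {t | ∃ u : H1 Ω, HasTrace Γ u t}
  zero_mem' := ⟨0, HasTrace.zero Γ⟩
  add_mem' := by
    rintro s t ⟨u, hu⟩ ⟨v, hv⟩
    exact ⟨u + v, hu.add hv⟩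
  smul_mem' := by
    rintro c s ⟨u, hu⟩
    exact ⟨c • u, hu.smul c⟩

/-- The trace space `H^{1/2}(Γ)`, as a vector space; its norm is the quotient norm `traceNorm`
(and not the `L²(Γ)`-norm). -/
def HHalf {d : ℕ} (Ω Γ : Set (EuclideanSpace ℝ (Fin d))) : Type := ↥(traces Ω Γ)

instance {d : ℕ} (Ω Γ : Set (EuclideanSpace ℝ (Fin d))) : AddCommGroup (HHalf Ω Γ) :=
  inferInstanceAs (AddCommGroup ↥(traces Ω Γ))

instance {d : ℕ} (Ω Γ : Set (EuclideanSpace ℝ (Fin d))) : Module ℝ (HHalf Ω Γ) :=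
  inferInstanceAs (Module ℝ ↥(traces Ω Γ))

/-- The element of `L²(Γ)` underlying an element of `H^{1/2}(Γ)`. -/
def HHalf.toL2 {d : ℕ} {Ω Γ : Set (EuclideanSpace ℝ (Fin d))} :
    HHalf Ω Γ →ₗ[ℝ] Lp ℝ 2 (surfaceMeasure Γ) := (traces Ω Γ).subtype

theorem HHalf.exists_hasTrace {d : ℕ} {Ω Γ : Set (EuclideanSpace ℝ (Fin d))} (t : HHalf Ω Γ) :
    ∃ u : H1 Ω, HasTrace Γ u t.toL2 := t.2

/-- `‖t‖_{H^{1/2}(Γ)} = inf {‖u‖_{H¹(Ω)} : u ∈ H¹(Ω), u|_Γ = t}`. -/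
def traceNorm {d : ℕ} {Ω Γ : Set (EuclideanSpace ℝ (Fin d))} (t : HHalf Ω Γ) : ℝ :=
  sInf {r : ℝ | ∃ u : H1 Ω, HasTrace Γ u t.toL2 ∧ r = ‖u‖}

theorem traceNorm_le {d : ℕ} {Ω Γ : Set (EuclideanSpace ℝ (Fin d))} {t : HHalf Ω Γ} {u : H1 Ω}
    (h : HasTrace Γ u t.toL2) : traceNorm t ≤ ‖u‖ :=
  csInf_le ⟨0, by rintro r ⟨v, -, rfl⟩; exact norm_nonneg v⟩ ⟨u, h, rfl⟩

theorem exists_lt_traceNorm_add {d : ℕ} {Ω Γ : Set (EuclideanSpace ℝ (Fin d))} (t : HHalf Ω Γ)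
    {ε : ℝ} (hε : 0 < ε) : ∃ u : H1 Ω, HasTrace Γ u t.toL2 ∧ ‖u‖ < traceNorm t + ε := by
  obtain ⟨v, hv⟩ := t.exists_hasTrace
  obtain ⟨r, ⟨u, hu, rfl⟩, hr⟩ :=
    Real.lt_sInf_add_pos (s := {r : ℝ | ∃ u : H1 Ω, HasTrace Γ u t.toL2 ∧ r = ‖u‖})
      ⟨‖v‖, v, hv, rfl⟩ hε
  exact ⟨u, hu, hr⟩

/-- The quotient norm as a seminorm. -/
def traceSeminorm {d : ℕ} (Ω Γ : Set (EuclideanSpace ℝ (Fin d))) : Seminorm ℝ (HHalf Ω Γ) :=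
  Seminorm.ofSMulLE traceNorm
    (by
      apply le_antisymm
      · have h := traceNorm_le (t := (0 : HHalf Ω Γ)) (u := 0)
          (by rw [map_zero]; exact HasTrace.zero Γ)
        rwa [norm_zero] at h
      · exact Real.sInf_nonneg (by rintro r ⟨v, -, rfl⟩; exact norm_nonneg v))
    (by
      intro s t
      refine le_of_forall_pos_le_add (fun ε hε => ?_)
      obtain ⟨u, hu, hu'⟩ := exists_lt_traceNorm_add s (half_pos hε)
      obtain ⟨v, hv, hv'⟩ := exists_lt_traceNorm_add t (half_pos hε)
      have h := traceNorm_le (t := s + t) (by rw [map_add]; exact hu.add hv)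
      have := norm_add_le u v
      linarith)
    (by
      intro c t
      refine le_of_forall_pos_le_add (fun ε hε => ?_)
      have hc : 0 < ‖c‖ + 1 := by positivity
      obtain ⟨u, hu, hu'⟩ := exists_lt_traceNorm_add t (div_pos hε hc)
      have h := traceNorm_le (t := c • t) (by rw [map_smul]; exact hu.smul c)
      rw [norm_smul] at h
      have h1 : ‖c‖ * ‖u‖ ≤ ‖c‖ * (traceNorm t + ε / (‖c‖ + 1)) := by gcongr
      have h2 : ‖c‖ * (ε / (‖c‖ + 1)) ≤ ε := by
        rw [mul_div_assoc', div_le_iff₀ hc]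
        nlinarith [norm_nonneg c]
      linarith)

instance {d : ℕ} (Ω Γ : Set (EuclideanSpace ℝ (Fin d))) : SeminormedAddCommGroup (HHalf Ω Γ) :=
  (traceSeminorm Ω Γ).toAddGroupSeminorm.toSeminormedAddCommGroup

instance {d : ℕ} (Ω Γ : Set (EuclideanSpace ℝ (Fin d))) : NormedSpace ℝ (HHalf Ω Γ) where
  norm_smul_le c t := (map_smul_eq_mul (traceSeminorm Ω Γ) c t).le

/-- `u` is a weak solution of `Δu = f` in `Ω`, `∂_ν u + a β(u) = g` on `Γ`, `u = 0` on `Γ₀`: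
for all `v ∈ H¹(Ω)` with `v|_{Γ₀} = 0`,
`∫_Ω ∇u · ∇v dx + ∫_Γ a β(u) v ds = - ⟨f, v⟩ + ⟨g, v|_Γ⟩`.
Here `t` is the trace of `u` on `Γ` and `s` is the trace of `v` on `Γ`; the data `f` and `g` are
elements of the duals of `H¹(Ω)` and of `H^{1/2}(Γ)`. -/
def IsWeakSolution {d : ℕ} {Ω Γ Γ₀ : Set (EuclideanSpace ℝ (Fin d))} (β : ℝ → ℝ)
    (a : EuclideanSpace ℝ (Fin d) → ℝ) (f : StrongDual ℝ (H1 Ω)) (g : StrongDual ℝ (HHalf Ω Γ))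
    (u : H1Diamond Ω Γ₀) : Prop :=
  ∃ t : HHalf Ω Γ, HasTrace Γ (u : H1 Ω) t.toL2 ∧
    ∀ (v : H1Diamond Ω Γ₀) (s : HHalf Ω Γ), HasTrace Γ (v : H1 Ω) s.toL2 →
      (∫ x in Ω, inner ℝ (weakGrad (u : H1 Ω) x) (weakGrad (v : H1 Ω) x)) +
        (∫ x, a x * β (t.toL2 x) * s.toL2 x ∂(surfaceMeasure Γ)) = - f (v : H1 Ω) + g s

end RobinProblem

end

noncomputable section

open scoped NNReal

namespace RobinProblem

/-! The weak problem is an equation `F u = b` in the Hilbert space `V` of `H¹` functions vanishing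
on `Γ₀`. With `G` the gradient, `T` the trace on `Γ` and `N t = a β(t)` on `L²(Γ)`, the operator is
`F = G* G + T* N T`. Since `a ≥ 0` and `β` is non-decreasing, `N` is monotone; since `a` and `β'`
are bounded, `N` is Lipschitz. A Poincaré inequality makes `G* G` coercive with some `α > 0`, so `F`
is strongly monotone and Lipschitz, hence bijective (`bijective_of_stronglyMonotone`). Because `β 0
= 0` gives `F 0 = 0`, testing with `u` yields `α ‖u‖² ≤ (‖f‖ + ‖g‖) ‖u‖`. The bound thus involves
only `α`; the Lipschitz constant, which depends on `a` and `β`, serves existence alone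
(`existsUnique_of_coercive`).

The analytic input is the trace inequality on `Γ` and the Poincaré inequality relative to `Γ₀`. Both
are proved for smooth functions by integrating the gradient along segments. For the trace, the
segments are columns standing on a boundary graph (`exists_trace_le`). For Poincaré, columns over
`Γ₀` control one ball (`exists_ball_le`); translations carry the control through the connected set
`Ω` and up to its boundary (`exists_poincare`), so no compact embedding is needed. Both inequalities
pass to `H¹` because traces are defined as limits of restrictions of smooth functions. -/

/-! ### Integration along segments and translation estimates -/

theorem add_sq_le_two_mul (x y : ℝ≥0∞) : (x + y) ^ 2 ≤ 2 * x ^ 2 + 2 * y ^ 2 := by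
  have h := ENNReal.rpow_add_le_mul_rpow_add_rpow x y (p := 2) (by norm_num)
  norm_num at h
  rwa [mul_add] at h

/-- The Cauchy–Schwarz inequality against the constant function `1`. -/
theorem sq_lintegral_le {α : Type*} [MeasurableSpace α] (μ : Measure α) {f : α → ℝ≥0∞}
    (hf : AEMeasurable f μ) : (∫⁻ x, f x ∂μ) ^ 2 ≤ μ Set.univ * ∫⁻ x, f x ^ 2 ∂μ := by
  have h := ENNReal.lintegral_mul_le_Lp_mul_Lq μ Real.HolderConjugate.two_two
    (aemeasurable_const (b := (1 : ℝ≥0∞))) hf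
  simp only [Pi.mul_apply, one_mul, ENNReal.one_rpow, lintegral_const] at h
  calc (∫⁻ x, f x ∂μ) ^ 2
      ≤ ((μ Set.univ) ^ (1 / 2 : ℝ) * (∫⁻ x, f x ^ (2 : ℝ) ∂μ) ^ (1 / 2 : ℝ)) ^ 2 := by gcongr
    _ = μ Set.univ * ∫⁻ x, f x ^ 2 ∂μ := by
      rw [mul_pow, ← ENNReal.rpow_natCast, ← ENNReal.rpow_natCast, ← ENNReal.rpow_mul,
        ← ENNReal.rpow_mul]
      norm_num

/-- The difference `ψ p - ψ q` is the integral of `ψ'` between two points of `[0, h]`;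
Cauchy–Schwarz on this interval costs the factor `h`. -/
theorem enorm_sq_le_of_contDiff {ψ : ℝ → ℝ} (hψ : ContDiff ℝ 1 ψ) {h p q : ℝ}
    (hp : p ∈ Set.Icc 0 h) (hq : q ∈ Set.Icc 0 h) :
    ‖ψ p‖ₑ ^ 2 ≤ 2 * ‖ψ q‖ₑ ^ 2
      + 2 * (ENNReal.ofReal h * ∫⁻ τ in Set.Ioo 0 h, ‖deriv ψ τ‖ₑ ^ 2) := by
  have hd : Continuous (deriv ψ) := hψ.continuous_deriv le_rfl
  have h1 : ψ p - ψ q = ∫ τ in q..p, deriv ψ τ :=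
    (intervalIntegral.integral_deriv_eq_sub (fun x _ => hψ.differentiable (by simp) x)
      (hd.intervalIntegrable _ _)).symm
  have h2 : ‖ψ p - ψ q‖ₑ ≤ ∫⁻ τ in Set.Ioo 0 h, ‖deriv ψ τ‖ₑ := by
    rw [h1, intervalIntegral.intervalIntegral_eq_integral_uIoc, enorm_smul]
    have : ‖(if q ≤ p then 1 else -1 : ℝ)‖ₑ = 1 := by split_ifs <;> simp
    rw [this, one_mul]
    refine (enorm_integral_le_lintegral_enorm _).trans ?_
    rw [restrict_Ioo_eq_restrict_Ioc]
    refine lintegral_mono_set ?_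
    rw [Set.uIoc]
    exact Set.Ioc_subset_Ioc (le_min hq.1 hp.1) (max_le hq.2 hp.2)
  have h3 := sq_lintegral_le (volume.restrict (Set.Ioo 0 h))
    (f := fun τ => ‖deriv ψ τ‖ₑ) hd.enorm.measurable.aemeasurable
  simp only [Measure.restrict_apply_univ, Real.volume_Ioo, sub_zero] at h3
  calc ‖ψ p‖ₑ ^ 2 ≤ (‖ψ q‖ₑ + ‖ψ p - ψ q‖ₑ) ^ 2 := by
        gcongr
        calc ‖ψ p‖ₑ = ‖ψ q + (ψ p - ψ q)‖ₑ := by congr 1; ring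
          _ ≤ _ := enorm_add_le _ _
    _ ≤ 2 * ‖ψ q‖ₑ ^ 2 + 2 * ‖ψ p - ψ q‖ₑ ^ 2 := add_sq_le_two_mul _ _
    _ ≤ _ := by
      gcongr
      exact (pow_le_pow_left' h2 2).trans h3

/-- Values of a smooth function at two points of a segment, compared through the gradient. -/
theorem enorm_sq_le_on_segment {d : ℕ} {φ : EuclideanSpace ℝ (Fin d) → ℝ} (hφ : ContDiff ℝ ∞ φ)
    (x w : EuclideanSpace ℝ (Fin d)) {h p q : ℝ} (hp : p ∈ Set.Icc 0 h) (hq : q ∈ Set.Icc 0 h) :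
    ‖φ (x + p • w)‖ₑ ^ 2 ≤ 2 * ‖φ (x + q • w)‖ₑ ^ 2
      + 2 * ‖w‖ₑ ^ 2 * ENNReal.ofReal h * ∫⁻ τ in Set.Ioo 0 h, ‖∇ φ (x + τ • w)‖ₑ ^ 2 := by
  have hψ : ContDiff ℝ 1 (fun τ : ℝ => φ (x + τ • w)) :=
    (hφ.of_le (by exact_mod_cast le_top)).comp (by fun_prop)
  have key := enorm_sq_le_of_contDiff hψ hp hq
  refine key.trans ?_
  have hm : Measurable fun τ : ℝ => ‖∇ φ (x + τ • w)‖ₑ ^ 2 :=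
    ((continuous_gradient_of_contDiff hφ).comp (by fun_prop : Continuous fun τ : ℝ =>
      x + τ • w)).enorm.measurable.pow_const 2
  have hder : ∀ τ : ℝ, ‖deriv (fun τ : ℝ => φ (x + τ • w)) τ‖ₑ ^ 2
      ≤ ‖w‖ₑ ^ 2 * ‖∇ φ (x + τ • w)‖ₑ ^ 2 := by
    intro τ
    have hd : HasDerivAt (fun τ : ℝ => φ (x + τ • w)) (fderiv ℝ φ (x + τ • w) w) τ := by
      have h1 : HasFDerivAt φ (fderiv ℝ φ (x + τ • w)) (x + τ • w) :=
        (hφ.differentiable (by simp) _).hasFDerivAt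
      have h2 : HasDerivAt (fun τ : ℝ => x + τ • w) w τ := by
        simpa using ((hasDerivAt_id τ).smul_const w).const_add x
      exact h1.comp_hasDerivAt τ h2
    rw [hd.deriv, ← mul_pow, mul_comm]
    gcongr
    have : ‖∇ φ (x + τ • w)‖ₑ = ‖fderiv ℝ φ (x + τ • w)‖ₑ := by
      simp [gradient, enorm_eq_nnnorm]
    rw [this]
    exact ContinuousLinearMap.le_opENorm _ _
  have := lintegral_mono (μ := volume.restrict (Set.Ioo 0 h)) hder
  rw [lintegral_const_mul _ hm] at this
  calc _ ≤ 2 * ‖φ (x + q • w)‖ₑ ^ 2 + 2 * (ENNReal.ofReal h *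
        (‖w‖ₑ ^ 2 * ∫⁻ τ in Set.Ioo 0 h, ‖∇ φ (x + τ • w)‖ₑ ^ 2)) := by gcongr
    _ = _ := by ring

/-- Translation estimate: if the segments from `A` to `A + w` lie in `Ω`, then the `L²`-norm on `A`
is controlled by that on `A + w` and the norm of the gradient on `Ω`. -/
theorem lintegral_sq_le_translate {d : ℕ} {Ω A B : Set (EuclideanSpace ℝ (Fin d))}
    (w : EuclideanSpace ℝ (Fin d)) (hA : MeasurableSet A) (hΩ : MeasurableSet Ω)
    (hB : MeasurableSet B)
    (hseg : ∀ x ∈ A, ∀ t ∈ Set.Ioo (0 : ℝ) 1, x + t • w ∈ Ω) (hAB : ∀ x ∈ A, x + w ∈ B)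
    {φ : EuclideanSpace ℝ (Fin d) → ℝ} (hφ : ContDiff ℝ ∞ φ) :
    ∫⁻ x in A, ‖φ x‖ₑ ^ 2 ≤ 2 * (∫⁻ x in B, ‖φ x‖ₑ ^ 2)
      + 2 * ‖w‖ₑ ^ 2 * ∫⁻ x in Ω, ‖∇ φ x‖ₑ ^ 2 := by
  have hg : Measurable fun x => ‖∇ φ x‖ₑ ^ 2 :=
    (continuous_gradient_of_contDiff hφ).enorm.measurable.pow_const 2
  have hf : Measurable fun x => ‖φ x‖ₑ ^ 2 := hφ.continuous.enorm.measurable.pow_const 2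
  -- Translation invariance of Lebesgue measure, applied to indicator functions.
  have shift : ∀ (F : EuclideanSpace ℝ (Fin d) → ℝ≥0∞) (v : EuclideanSpace ℝ (Fin d))
      (D : Set (EuclideanSpace ℝ (Fin d))), MeasurableSet D → (∀ x ∈ A, x + v ∈ D) →
      ∫⁻ x in A, F (x + v) ≤ ∫⁻ x in D, F x := by
    intro F v D hD h
    rw [← lintegral_indicator hA, ← lintegral_indicator hD,
      ← lintegral_add_right_eq_self (D.indicator F) v]
    refine lintegral_mono fun x => ?_
    by_cases hx : x ∈ A
    · simp [hx, h x hx]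
    · simp [hx]
  have hm : Measurable fun z : EuclideanSpace ℝ (Fin d) × ℝ => ‖∇ φ (z.1 + z.2 • w)‖ₑ ^ 2 :=
    hg.comp (by fun_prop)
  calc ∫⁻ x in A, ‖φ x‖ₑ ^ 2
      ≤ ∫⁻ x in A, (2 * ‖φ (x + w)‖ₑ ^ 2
        + 2 * ‖w‖ₑ ^ 2 * ∫⁻ τ in Set.Ioo (0 : ℝ) 1, ‖∇ φ (x + τ • w)‖ₑ ^ 2) := by
        refine lintegral_mono fun x => ?_
        simpa using enorm_sq_le_on_segment hφ x w (h := 1) (p := 0) (q := 1) (by simp) (by simp)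
    _ = 2 * (∫⁻ x in A, ‖φ (x + w)‖ₑ ^ 2) + 2 * ‖w‖ₑ ^ 2 *
        ∫⁻ x in A, ∫⁻ τ in Set.Ioo (0 : ℝ) 1, ‖∇ φ (x + τ • w)‖ₑ ^ 2 := by
        rw [lintegral_add_left, lintegral_const_mul, lintegral_const_mul]
        · exact hm.lintegral_prod_right'
        · exact hf.comp (measurable_add_const w)
        · exact (hf.comp (measurable_add_const w)).const_mul _
    _ ≤ _ := by
      refine add_le_add (mul_le_mul_right ?_ _) (mul_le_mul_right ?_ _)
      · exact shift (fun x => ‖φ x‖ₑ ^ 2) w B hB hAB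
      -- After Tonelli, for each fixed `τ` the translate of `A` by `τ • w` lies in `Ω`, so the inner
      -- integral is at most the one over `Ω`.
      · rw [lintegral_lintegral_swap (f := fun x (τ : ℝ) => ‖∇ φ (x + τ • w)‖ₑ ^ 2)
          hm.aemeasurable]
        calc ∫⁻ τ in Set.Ioo (0 : ℝ) 1, ∫⁻ x in A, ‖∇ φ (x + τ • w)‖ₑ ^ 2
            ≤ ∫⁻ τ in Set.Ioo (0 : ℝ) 1, ∫⁻ x in Ω, ‖∇ φ x‖ₑ ^ 2 := by
              refine setLIntegral_mono measurable_const fun τ hτ => ?_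
              exact shift (fun x => ‖∇ φ x‖ₑ ^ 2) (τ • w) Ω hΩ fun x hx => hseg x hx τ hτ
          _ = _ := by simp

/-! ### Strongly monotone Lipschitz operators -/

/-- Zarantonello's theorem: a strongly monotone Lipschitz map of a Hilbert space is bijective. -/
theorem bijective_of_stronglyMonotone {V : Type*} [NormedAddCommGroup V] [InnerProductSpace ℝ V]
    [CompleteSpace V] {F : V → V} {α L : ℝ} (hα : 0 < α)
    (hmono : ∀ u v, α * ‖u - v‖ ^ 2 ≤ inner ℝ (F u - F v) (u - v))
    (hlip : ∀ u v, ‖F u - F v‖ ≤ L * ‖u - v‖) : Function.Bijective F := by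
  refine ⟨fun u v h => ?_, fun b => ?_⟩
  · have h1 := hmono u v
    rw [h, sub_self, inner_zero_left] at h1
    have : ‖u - v‖ ^ 2 = 0 := le_antisymm (by nlinarith) (by positivity)
    rwa [sq_eq_zero_iff, norm_eq_zero, sub_eq_zero] at this
  -- `M` is a Lipschitz constant exceeding `α`, which keeps `q` in `[0, 1)`.
  · set M : ℝ := max |L| α + 1 with hM
    have hLM : |L| ≤ M := (le_max_left _ _).trans (by linarith)
    have hαM : α < M := lt_of_le_of_lt (le_max_right _ _) (by linarith)
    have hMpos : 0 < M := hα.trans hαM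
    -- This step size minimizes `1 - 2 l α + l² M²`, the bound on the squared contraction factor of
    -- `u ↦ u - l (F u - b)`; the minimum is `q`.
    set l : ℝ := α / M ^ 2 with hl
    have hlpos : 0 < l := by positivity
    set q : ℝ := 1 - α ^ 2 / M ^ 2 with hq
    have hq0 : 0 ≤ q := by
      rw [hq, sub_nonneg, div_le_one (by positivity)]
      exact pow_le_pow_left₀ hα.le hαM.le 2
    have hq1 : q < 1 := by rw [hq]; linarith [show 0 < α ^ 2 / M ^ 2 by positivity]
    have hcontr : ContractingWith (Real.sqrt q).toNNReal
        (fun u => u - l • (F u - b)) := by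
      refine ⟨?_, LipschitzWith.of_dist_le_mul fun u v => ?_⟩
      · rw [← NNReal.coe_lt_coe]
        rw [Real.coe_toNNReal _ (Real.sqrt_nonneg _), NNReal.coe_one,
          Real.sqrt_lt' one_pos]
        simpa using hq1
      · rw [Real.coe_toNNReal _ (Real.sqrt_nonneg _), dist_eq_norm, dist_eq_norm]
        have e : u - l • (F u - b) - (v - l • (F v - b)) = (u - v) - l • (F u - F v) := by
          module
        rw [e]
        refine le_of_sq_le_sq ?_ (by positivity)
        rw [mul_pow, Real.sq_sqrt hq0, norm_sub_sq_real, inner_smul_right, norm_smul,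
          real_inner_comm, mul_pow, Real.norm_of_nonneg hlpos.le]
        have h1 := hmono u v
        have h2 : ‖F u - F v‖ ^ 2 ≤ M ^ 2 * ‖u - v‖ ^ 2 := by
          rw [← mul_pow]
          refine pow_le_pow_left₀ (norm_nonneg _) ((hlip u v).trans ?_) 2
          gcongr
          exact (le_abs_self L).trans hLM
        have h3 : l ^ 2 * ‖F u - F v‖ ^ 2 ≤ l ^ 2 * (M ^ 2 * ‖u - v‖ ^ 2) := by gcongr
        have h4 : l * (α * ‖u - v‖ ^ 2) ≤ l * inner ℝ (F u - F v) (u - v) := by gcongr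
        have h5 : l ^ 2 * M ^ 2 = α ^ 2 / M ^ 2 := by rw [hl]; field_simp
        have h6 : l * α = α ^ 2 / M ^ 2 := by rw [hl]; field_simp
        have h7 : l ^ 2 * (M ^ 2 * ‖u - v‖ ^ 2) = α ^ 2 / M ^ 2 * ‖u - v‖ ^ 2 := by
          rw [← mul_assoc, h5]
        have h8 : l * (α * ‖u - v‖ ^ 2) = α ^ 2 / M ^ 2 * ‖u - v‖ ^ 2 := by
          rw [← mul_assoc, h6]
        rw [hq, sub_mul, one_mul]
        linarith
    refine ⟨hcontr.fixedPoint, ?_⟩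
    have h : _ - l • (F _ - b) = _ := hcontr.fixedPoint_isFixedPt
    rw [sub_eq_self, smul_eq_zero] at h
    rcases h with h | h
    · exact absurd h hlpos.ne'
    · exact sub_eq_zero.1 h

/-! ### Surface measure on graphs and orthogonal coordinates -/

/-- The normalizing factor depends only on `n`, so it is the same in both spaces and the estimate
for the plain Hausdorff measure carries over. -/
theorem _root_.LipschitzOnWith.euclideanHausdorffMeasure_image_le {X Y : Type*}
    [EMetricSpace X] [EMetricSpace Y] [MeasurableSpace X] [BorelSpace X] [MeasurableSpace Y]
    [BorelSpace Y] {K : ℝ≥0} {f : X → Y} {s : Set X} (h : LipschitzOnWith K f s) (n : ℕ) :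
    (Measure.euclideanHausdorffMeasure n : Measure Y) (f '' s)
      ≤ (K : ℝ≥0∞) ^ n * (Measure.euclideanHausdorffMeasure n : Measure X) s := by
  have := h.hausdorffMeasure_image_le (d := n) (Nat.cast_nonneg n)
  rw [Measure.euclideanHausdorffMeasure_def, Measure.euclideanHausdorffMeasure_def,
    Measure.smul_apply, Measure.smul_apply, ENNReal.smul_def, ENNReal.smul_def, smul_eq_mul,
    smul_eq_mul, mul_left_comm]
  gcongr
  simpa using this

variable {d : ℕ}

/-- The hyperplane orthogonal to `ν`. -/
abbrev normalPlane (ν : EuclideanSpace ℝ (Fin d)) : Submodule ℝ (EuclideanSpace ℝ (Fin d)) :=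
  (Submodule.span ℝ {ν})ᗮ

/-- The orthogonal projection onto the hyperplane orthogonal to `ν`. -/
abbrev planeProj (ν : EuclideanSpace ℝ (Fin d)) :
    EuclideanSpace ℝ (Fin d) →L[ℝ] normalPlane ν :=
  (normalPlane ν).orthogonalProjectionOnto

theorem coe_planeProj {ν : EuclideanSpace ℝ (Fin d)} (hν : ‖ν‖ = 1)
    (x : EuclideanSpace ℝ (Fin d)) : (planeProj ν x : EuclideanSpace ℝ (Fin d))
      = x - inner ℝ ν x • ν := by
  have h := Submodule.starProjection_add_starProjection_orthogonal
    (K := Submodule.span ℝ {ν}) x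
  rw [Submodule.starProjection_unit_singleton ℝ hν x] at h
  exact eq_sub_of_add_eq' h

theorem inner_normalPlane {ν : EuclideanSpace ℝ (Fin d)} (y : normalPlane ν) :
    inner ℝ ν (y : EuclideanSpace ℝ (Fin d)) = 0 :=
  Submodule.mem_orthogonal_singleton_iff_inner_right.1 y.2

theorem inner_add_smul {ν : EuclideanSpace ℝ (Fin d)} (hν : ‖ν‖ = 1) (y : normalPlane ν) (s : ℝ) :
    inner ℝ ν ((y : EuclideanSpace ℝ (Fin d)) + s • ν) = s := by
  rw [inner_add_right, inner_normalPlane, inner_smul_right, real_inner_self_eq_norm_sq, hν]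
  ring

theorem planeProj_add_smul {ν : EuclideanSpace ℝ (Fin d)} (hν : ‖ν‖ = 1) (y : normalPlane ν)
    (s : ℝ) : planeProj ν ((y : EuclideanSpace ℝ (Fin d)) + s • ν) = y := by
  apply Subtype.ext
  rw [coe_planeProj hν, inner_add_smul hν, add_sub_cancel_right]

theorem planeProj_add_inner_smul {ν : EuclideanSpace ℝ (Fin d)} (hν : ‖ν‖ = 1)
    (x : EuclideanSpace ℝ (Fin d)) :
    (planeProj ν x : EuclideanSpace ℝ (Fin d)) + inner ℝ ν x • ν = x := by
  rw [coe_planeProj hν, sub_add_cancel]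

/-- Orthogonal coordinates `(y, s) ↦ y + s • ν`. -/
def planeCoordinates {ν : EuclideanSpace ℝ (Fin d)} (hν : ‖ν‖ = 1) :
    (normalPlane ν × ℝ) ≃L[ℝ] EuclideanSpace ℝ (Fin d) :=
  LinearEquiv.toContinuousLinearEquiv
    { toFun := fun z => (z.1 : EuclideanSpace ℝ (Fin d)) + z.2 • ν
      invFun := fun x => (planeProj ν x, inner ℝ ν x)
      map_add' := fun z w => by simp only [Prod.fst_add, Prod.snd_add, Submodule.coe_add]; module
      map_smul' := fun c z => by
        simp only [Prod.smul_fst, Prod.smul_snd, Submodule.coe_smul, RingHom.id_apply, smul_eq_mul]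
        module
      left_inv := fun z => Prod.ext (planeProj_add_smul hν z.1 z.2) (inner_add_smul hν z.1 z.2)
      right_inv := fun x => planeProj_add_inner_smul hν x }

theorem isAddHaarMeasure_normalPlane {ν : EuclideanSpace ℝ (Fin d)} (hν : ‖ν‖ = 1) :
    (Measure.euclideanHausdorffMeasure (d - 1) : Measure (normalPlane ν)).IsAddHaarMeasure := by
  have hν0 : ν ≠ 0 := by
    rintro rfl
    simp at hν
  -- A unit vector exists only if `d > 0`, so the truncated difference `d - 1` is the true dimension
  -- of the hyperplane.
  have hd : Module.finrank ℝ (EuclideanSpace ℝ (Fin d)) = (d - 1) + 1 := by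
    have : 0 < d := by
      rcases Nat.eq_zero_or_pos d with rfl | h
      · exact absurd (Subsingleton.elim ν 0) hν0
      · exact h
    rw [finrank_euclideanSpace_fin]; omega
  have : Fact (Module.finrank ℝ (EuclideanSpace ℝ (Fin d)) = (d - 1) + 1) := ⟨hd⟩
  have h := Submodule.finrank_orthogonal_span_singleton (𝕜 := ℝ) (n := d - 1) hν0
  have key := isAddHaarMeasure_euclideanHausdorffMeasure (E := normalPlane ν)
  rwa [h] at key

/-- The image of the product measure under the linear coordinates is an additive Haar measure, hence
a multiple of Lebesgue measure. Only `0 < c < ∞` matters, never the value of `c`. -/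
theorem exists_lintegral_normalPlane {ν : EuclideanSpace ℝ (Fin d)} (hν : ‖ν‖ = 1) :
    ∃ c : ℝ≥0, c ≠ 0 ∧ ∀ G : EuclideanSpace ℝ (Fin d) → ℝ≥0∞, Measurable G →
      ∫⁻ y : normalPlane ν, ∫⁻ s : ℝ, G (y + s • ν)
        ∂volume ∂(Measure.euclideanHausdorffMeasure (d - 1)) = c * ∫⁻ x, G x := by
  have := isAddHaarMeasure_normalPlane hν
  set m : Measure (normalPlane ν) := Measure.euclideanHausdorffMeasure (d - 1)
  set M : Measure (EuclideanSpace ℝ (Fin d)) :=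
    (m.prod (volume : Measure ℝ)).map (planeCoordinates hν) with hM
  have : M.IsAddHaarMeasure := (planeCoordinates hν).isAddHaarMeasure_map _
  refine ⟨M.addHaarScalarFactor volume, (Measure.addHaarScalarFactor_pos_of_isAddHaarMeasure _ _).ne',
    fun G hG => ?_⟩
  have h1 := Measure.isAddLeftInvariant_eq_smul M volume
  have h2 : ∫⁻ x, G x ∂M = M.addHaarScalarFactor volume * ∫⁻ x, G x := by
    conv_lhs => rw [h1]
    rw [ENNReal.smul_def, lintegral_smul_measure, smul_eq_mul]
  rw [← h2, hM, lintegral_map hG (planeCoordinates hν).continuous.measurable,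
    lintegral_prod (fun z => G (planeCoordinates hν z))
      (hG.comp (planeCoordinates hν).continuous.measurable).aemeasurable]
  rfl

/-- The graph parametrization `y ↦ y + γ(y) ν` over the hyperplane orthogonal to `ν`. -/
def graphMap (ν : EuclideanSpace ℝ (Fin d)) (γ : EuclideanSpace ℝ (Fin d) → ℝ)
    (y : normalPlane ν) : EuclideanSpace ℝ (Fin d) := y + γ y • ν

theorem continuous_graphMap {ν : EuclideanSpace ℝ (Fin d)} {γ : EuclideanSpace ℝ (Fin d) → ℝ}
    (hγ : Continuous γ) : Continuous (graphMap ν γ) := by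
  unfold graphMap; fun_prop

theorem planeProj_graphMap {ν : EuclideanSpace ℝ (Fin d)} (hν : ‖ν‖ = 1)
    (γ : EuclideanSpace ℝ (Fin d) → ℝ) (y : normalPlane ν) : planeProj ν (graphMap ν γ y) = y :=
  planeProj_add_smul hν y _

/-- Shearing by `γ` translates each vertical line, which leaves the inner integral unchanged. -/
theorem exists_lintegral_graph {ν : EuclideanSpace ℝ (Fin d)} (hν : ‖ν‖ = 1)
    {γ : EuclideanSpace ℝ (Fin d) → ℝ} :
    ∃ c : ℝ≥0, c ≠ 0 ∧ ∀ G : EuclideanSpace ℝ (Fin d) → ℝ≥0∞, Measurable G →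
      ∫⁻ y : normalPlane ν, ∫⁻ s : ℝ, G (graphMap ν γ y + s • ν)
        ∂volume ∂(Measure.euclideanHausdorffMeasure (d - 1)) = c * ∫⁻ x, G x := by
  obtain ⟨c, hc, h⟩ := exists_lintegral_normalPlane hν
  refine ⟨c, hc, fun G hG => ?_⟩
  rw [← h G hG]
  congr 1
  funext y
  rw [← lintegral_add_right_eq_self (fun s : ℝ => G (y + s • ν)) (γ y)]
  congr 1
  funext s
  congr 1
  rw [graphMap]
  module

/-- The projection is 1-Lipschitz and inverts the graph map, so a graph has at least the measure of
its shadow. Together with `le_map_graphMap` this replaces the area formula. -/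
theorem map_graphMap_le {ν : EuclideanSpace ℝ (Fin d)} (hν : ‖ν‖ = 1)
    {γ : EuclideanSpace ℝ (Fin d) → ℝ} (hγ : Continuous γ) {D : Set (normalPlane ν)}
    {S : Set (EuclideanSpace ℝ (Fin d))} (hDS : ∀ y ∈ D, graphMap ν γ y ∈ S) :
    ((Measure.euclideanHausdorffMeasure (d - 1) : Measure (normalPlane ν)).restrict D).map
      (graphMap ν γ) ≤ surfaceMeasure S := by
  have hg := (continuous_graphMap (ν := ν) hγ).measurable
  refine Measure.le_iff.2 fun A hA => ?_
  rw [Measure.map_apply hg hA, Measure.restrict_apply (hg hA), Measure.restrict_apply hA]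
  have h1 : graphMap ν γ ⁻¹' A ∩ D ⊆ planeProj ν '' (A ∩ S) := fun y hy =>
    ⟨graphMap ν γ y, ⟨hy.1, hDS y hy.2⟩, planeProj_graphMap hν γ y⟩
  have hlip : LipschitzWith 1 (planeProj ν) :=
    LipschitzWith.of_dist_le_mul fun x z => by
      rw [dist_eq_norm, dist_eq_norm, ← map_sub, NNReal.coe_one, one_mul]
      exact Submodule.norm_orthogonalProjectionOnto_apply_le _ _
  refine (measure_mono h1).trans ?_
  simpa using (hlip.lipschitzOnWith (s := A ∩ S)).euclideanHausdorffMeasure_image_le (d - 1)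

/-- The opposite comparison: the `K`-Lipschitz graph map enlarges `(d - 1)`-dimensional measure by
at most `K ^ (d - 1)`. -/
theorem le_map_graphMap {ν : EuclideanSpace ℝ (Fin d)}
    {γ : EuclideanSpace ℝ (Fin d) → ℝ} (hγ : Continuous γ) {D : Set (normalPlane ν)} {K : ℝ≥0}
    (hK : LipschitzOnWith K (graphMap ν γ) D)
    {S : Set (EuclideanSpace ℝ (Fin d))} (hDS : S ⊆ graphMap ν γ '' D) :
    surfaceMeasure S ≤ ((K : ℝ≥0∞) ^ (d - 1)) •
      ((Measure.euclideanHausdorffMeasure (d - 1) : Measure (normalPlane ν)).restrict D).map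
      (graphMap ν γ) := by
  have hg := (continuous_graphMap (ν := ν) hγ).measurable
  refine Measure.le_iff.2 fun A hA => ?_
  rw [Measure.smul_apply, Measure.map_apply hg hA, Measure.restrict_apply (hg hA),
    Measure.restrict_apply hA]
  have h1 : A ∩ S ⊆ graphMap ν γ '' (graphMap ν γ ⁻¹' A ∩ D) := by
    rintro x ⟨hx, hxS⟩
    obtain ⟨y, hy, rfl⟩ := hDS hxS
    exact ⟨y, ⟨hx, hy⟩, rfl⟩
  exact (measure_mono h1).trans
    ((hK.mono Set.inter_subset_right).euclideanHausdorffMeasure_image_le (d - 1))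

/-! ### Estimates near a boundary point -/

/-- In the ball `B(x₀, r)` the set `Ω` is the strict epigraph of `γ` in direction `ν`, and `S` is
the graph. -/
structure IsLocalEpigraph (Ω S : Set (EuclideanSpace ℝ (Fin d))) (x₀ ν : EuclideanSpace ℝ (Fin d))
    (γ : EuclideanSpace ℝ (Fin d) → ℝ) (r : ℝ) : Prop where
  pos : 0 < r
  norm_eq : ‖ν‖ = 1
  contDiff : ContDiff ℝ 1 γ
  mem_iff : ∀ x ∈ Metric.ball x₀ r, x ∈ Ω ↔ γ (planeProj ν x) < inner ℝ ν x
  boundary_iff : ∀ x ∈ Metric.ball x₀ r, x ∈ S ↔ γ (planeProj ν x) = inner ℝ ν x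

namespace IsLocalEpigraph

variable {Ω S : Set (EuclideanSpace ℝ (Fin d))} {x₀ ν : EuclideanSpace ℝ (Fin d)}
  {γ : EuclideanSpace ℝ (Fin d) → ℝ} {r : ℝ}

theorem center_eq (H : IsLocalEpigraph Ω S x₀ ν γ r) (hx₀ : x₀ ∈ S) :
    graphMap ν γ (planeProj ν x₀) = x₀ := by
  rw [graphMap, (H.boundary_iff x₀ (Metric.mem_ball_self H.pos)).1 hx₀,
    planeProj_add_inner_smul H.norm_eq]

/-- A disc in the hyperplane over which the graph parametrizes a part of `S` with a cylinder above
it in `Ω`. -/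
theorem exists_disc (H : IsLocalEpigraph Ω S x₀ ν γ r) (hx₀ : x₀ ∈ S) :
    ∃ ρ > 0, ∃ K : ℝ≥0, LipschitzOnWith K (graphMap ν γ) (Metric.ball (planeProj ν x₀) ρ) ∧
      ∀ y ∈ Metric.ball (planeProj ν x₀) ρ, graphMap ν γ y ∈ S ∧
        ∀ s ∈ Set.Ioo 0 (r / 2), graphMap ν γ y + s • ν ∈ Ω := by
  have hcd : ContDiff ℝ 1 (graphMap ν γ) := by
    have h1 : ContDiff ℝ 1 (fun y : normalPlane ν => (y : EuclideanSpace ℝ (Fin d))) :=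
      (normalPlane ν).subtypeL.contDiff
    exact h1.add ((H.contDiff.comp h1).smul contDiff_const)
  obtain ⟨K, t, ht, hK⟩ := (hcd.contDiffAt (x := planeProj ν x₀)).exists_lipschitzOnWith
  -- Keeping the graph within `r / 2` of `x₀` leaves room for columns of height `r / 2` inside the
  -- ball where the epigraph description holds.
  have hcont : graphMap ν γ ⁻¹' Metric.ball x₀ (r / 2) ∈ 𝓝 (planeProj ν x₀) := by
    refine hcd.continuous.continuousAt ?_
    rw [H.center_eq hx₀]
    exact Metric.ball_mem_nhds _ (half_pos H.pos)
  obtain ⟨ρ, hρ, hsub⟩ := Metric.mem_nhds_iff.1 (inter_mem ht hcont)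
  refine ⟨ρ, hρ, K, hK.mono fun y hy => (hsub hy).1, fun y hy => ?_⟩
  have hy' : graphMap ν γ y ∈ Metric.ball x₀ (r / 2) := (hsub hy).2
  have hinner : ∀ s : ℝ, inner ℝ ν (graphMap ν γ y + s • ν) = γ y + s := fun s => by
    rw [graphMap, add_assoc, ← add_smul, inner_add_smul H.norm_eq]
  have hproj : ∀ s : ℝ, planeProj ν (graphMap ν γ y + s • ν) = y := fun s => by
    rw [graphMap, add_assoc, ← add_smul, planeProj_add_smul H.norm_eq]
  refine ⟨?_, fun s hs => ?_⟩
  · rw [H.boundary_iff _ (Metric.ball_subset_ball (by linarith [H.pos]) hy')]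
    have h1 := hinner 0
    have h2 := hproj 0
    rw [zero_smul, add_zero] at h1 h2
    rw [h1, h2, add_zero]
  · rw [H.mem_iff, hinner, hproj]
    · linarith [hs.1]
    · rw [Metric.mem_ball, dist_eq_norm] at hy' ⊢
      calc ‖graphMap ν γ y + s • ν - x₀‖ = ‖(graphMap ν γ y - x₀) + s • ν‖ := by congr 1; abel
        _ ≤ ‖graphMap ν γ y - x₀‖ + ‖s • ν‖ := norm_add_le _ _
        _ < r / 2 + r / 2 := by
          rw [norm_smul, H.norm_eq, mul_one, Real.norm_of_nonneg hs.1.le]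
          exact add_lt_add hy' hs.2
        _ = r := by ring

end IsLocalEpigraph

section

variable {d : ℕ}

theorem planeProj_translate {ν : EuclideanSpace ℝ (Fin d)} (hν : ‖ν‖ = 1)
    (x : EuclideanSpace ℝ (Fin d)) (s : ℝ) : planeProj ν (x + s • ν) = planeProj ν x := by
  apply Subtype.ext
  rw [coe_planeProj hν, coe_planeProj hν, inner_add_right, inner_smul_right,
    real_inner_self_eq_norm_sq, hν]
  module

theorem inner_translate {ν : EuclideanSpace ℝ (Fin d)} (hν : ‖ν‖ = 1)
    (x : EuclideanSpace ℝ (Fin d)) (s : ℝ) : inner ℝ ν (x + s • ν) = inner ℝ ν x + s := by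
  rw [inner_add_right, inner_smul_right, real_inner_self_eq_norm_sq, hν]
  ring

section Column

variable {φ : EuclideanSpace ℝ (Fin d) → ℝ} (hφ : ContDiff ℝ ∞ φ)
  {ν : EuclideanSpace ℝ (Fin d)} (hν : ‖ν‖ = 1) {h : ℝ} (hh : 0 < h)
  (x : EuclideanSpace ℝ (Fin d))

include hφ hν hh

/-- The value at the base of a column is controlled by the norms over the column. -/
theorem enorm_sq_le_column : ENNReal.ofReal h * ‖φ x‖ₑ ^ 2
    ≤ 2 * (∫⁻ s in Set.Ioo 0 h, ‖φ (x + s • ν)‖ₑ ^ 2)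
      + 2 * ENNReal.ofReal h ^ 2 * ∫⁻ s in Set.Ioo 0 h, ‖∇ φ (x + s • ν)‖ₑ ^ 2 := by
  have hf : Measurable fun s : ℝ => ‖φ (x + s • ν)‖ₑ ^ 2 :=
    (hφ.continuous.comp (by fun_prop)).enorm.measurable.pow_const 2
  -- Averaging over the height `s` turns the pointwise comparison into one with the norm over the
  -- whole column.
  have h1 : ∫⁻ s in Set.Ioo 0 h, ‖φ x‖ₑ ^ 2 ≤ ∫⁻ s in Set.Ioo 0 h,
      (2 * ‖φ (x + s • ν)‖ₑ ^ 2
        + 2 * ENNReal.ofReal h * ∫⁻ τ in Set.Ioo 0 h, ‖∇ φ (x + τ • ν)‖ₑ ^ 2) := by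
    refine setLIntegral_mono ((hf.const_mul _).add_const _) fun s hs => ?_
    have := enorm_sq_le_on_segment hφ x ν (h := h) (p := 0) (q := s) ⟨le_rfl, hh.le⟩
      ⟨hs.1.le, hs.2.le⟩
    rw [zero_smul, add_zero] at this
    simpa [enorm_eq_nnnorm, nnnorm, hν] using this
  rw [lintegral_add_left (hf.const_mul _), lintegral_const_mul _ hf] at h1
  simp only [lintegral_const, Measure.restrict_apply_univ, Real.volume_Ioo, sub_zero] at h1
  calc _ = ‖φ x‖ₑ ^ 2 * ENNReal.ofReal h := mul_comm _ _
    _ ≤ _ := h1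
    _ = _ := by ring

/-- The norm over a column is controlled by the value at its base and the gradient. -/
theorem column_le_enorm_sq : ∫⁻ s in Set.Ioo 0 h, ‖φ (x + s • ν)‖ₑ ^ 2
    ≤ 2 * ENNReal.ofReal h * ‖φ x‖ₑ ^ 2
      + 2 * ENNReal.ofReal h ^ 2 * ∫⁻ s in Set.Ioo 0 h, ‖∇ φ (x + s • ν)‖ₑ ^ 2 := by
  have h1 : ∫⁻ s in Set.Ioo 0 h, ‖φ (x + s • ν)‖ₑ ^ 2 ≤ ∫⁻ s in Set.Ioo 0 h,
      (2 * ‖φ x‖ₑ ^ 2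
        + 2 * ENNReal.ofReal h * ∫⁻ τ in Set.Ioo 0 h, ‖∇ φ (x + τ • ν)‖ₑ ^ 2) := by
    refine setLIntegral_mono measurable_const fun s hs => ?_
    have := enorm_sq_le_on_segment hφ x ν (h := h) (p := s) (q := 0)
      ⟨hs.1.le, hs.2.le⟩ ⟨le_rfl, hh.le⟩
    rw [zero_smul, add_zero] at this
    simpa [enorm_eq_nnnorm, nnnorm, hν] using this
  refine h1.trans_eq ?_
  simp only [lintegral_const, Measure.restrict_apply_univ, Real.volume_Ioo, sub_zero]
  ring

end Column

namespace IsLocalEpigraph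

variable {Ω S : Set (EuclideanSpace ℝ (Fin d))} {x₀ ν : EuclideanSpace ℝ (Fin d)}
  {γ : EuclideanSpace ℝ (Fin d) → ℝ} {r : ℝ}

/-- Columns over a disc, integrated, against the volume integral over `Ω`. -/
theorem lintegral_columns_le {c : ℝ≥0} (hΩ : MeasurableSet Ω)
    (hc : ∀ G : EuclideanSpace ℝ (Fin d) → ℝ≥0∞, Measurable G →
      ∫⁻ y : normalPlane ν, ∫⁻ s : ℝ, G (graphMap ν γ y + s • ν)
        ∂volume ∂(Measure.euclideanHausdorffMeasure (d - 1)) = c * ∫⁻ x, G x)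
    {D : Set (normalPlane ν)} (hD : MeasurableSet D) {h : ℝ}
    (hsub : ∀ y ∈ D, ∀ s ∈ Set.Ioo 0 h, graphMap ν γ y + s • ν ∈ Ω)
    {G : EuclideanSpace ℝ (Fin d) → ℝ≥0∞} (hG : Measurable G) :
    ∫⁻ y in D, (∫⁻ s in Set.Ioo 0 h, G (graphMap ν γ y + s • ν))
      ∂(Measure.euclideanHausdorffMeasure (d - 1)) ≤ c * ∫⁻ x in Ω, G x := by
  rw [← lintegral_indicator hΩ, ← hc _ (hG.indicator hΩ), ← lintegral_indicator hD]
  refine lintegral_mono fun y => ?_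
  by_cases hy : y ∈ D
  · rw [Set.indicator_of_mem hy, ← lintegral_indicator measurableSet_Ioo]
    refine lintegral_mono fun s => ?_
    by_cases hs : s ∈ Set.Ioo 0 h
    · rw [Set.indicator_of_mem hs, Set.indicator_of_mem (hsub y hy s hs)]
    · rw [Set.indicator_of_notMem hs]; exact zero_le
  · rw [Set.indicator_of_notMem hy]; exact zero_le

/-- Reverse of `lintegral_columns_le`: a set covered by the columns has its integral bounded by
theirs, since outside `D` the fibres of `A` are empty. -/
theorem le_lintegral_columns {c : ℝ≥0} {A : Set (EuclideanSpace ℝ (Fin d))}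
    (hA : MeasurableSet A)
    (hc : ∀ G : EuclideanSpace ℝ (Fin d) → ℝ≥0∞, Measurable G →
      ∫⁻ y : normalPlane ν, ∫⁻ s : ℝ, G (graphMap ν γ y + s • ν)
        ∂volume ∂(Measure.euclideanHausdorffMeasure (d - 1)) = c * ∫⁻ x, G x)
    {D : Set (normalPlane ν)} (hD : MeasurableSet D) {h : ℝ}
    (hsub : ∀ y s, graphMap ν γ y + s • ν ∈ A → y ∈ D ∧ s ∈ Set.Ioo 0 h)
    {G : EuclideanSpace ℝ (Fin d) → ℝ≥0∞} (hG : Measurable G) :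
    c * ∫⁻ x in A, G x ≤ ∫⁻ y in D, (∫⁻ s in Set.Ioo 0 h, G (graphMap ν γ y + s • ν))
      ∂(Measure.euclideanHausdorffMeasure (d - 1)) := by
  rw [← lintegral_indicator hA, ← hc _ (hG.indicator hA), ← lintegral_indicator hD]
  refine lintegral_mono fun y => ?_
  by_cases hy : y ∈ D
  · rw [Set.indicator_of_mem hy, ← lintegral_indicator measurableSet_Ioo]
    refine lintegral_mono fun s => ?_
    by_cases hs : s ∈ Set.Ioo 0 h
    · rw [Set.indicator_of_mem hs]; exact Set.indicator_le_self _ _ _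
    · rw [Set.indicator_of_notMem fun h => hs (hsub y s h).2]; exact zero_le
  · rw [Set.indicator_of_notMem hy]
    refine (lintegral_eq_zero_iff' ?_).2 ?_ |>.le
    · exact ((hG.indicator hA).comp (by fun_prop)).aemeasurable
    · exact Eventually.of_forall fun s => Set.indicator_of_notMem (fun h => hy (hsub y s h).1) _

theorem measurable_column (hγ : Continuous γ) (h : ℝ) {G : EuclideanSpace ℝ (Fin d) → ℝ≥0∞}
    (hG : Measurable G) : Measurable fun y : normalPlane ν =>
      ∫⁻ s in Set.Ioo 0 h, G (graphMap ν γ y + s • ν) := by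
  have hcont : Continuous fun z : normalPlane ν × ℝ => graphMap ν γ z.1 + z.2 • ν :=
    ((continuous_graphMap hγ).comp continuous_fst).add (continuous_snd.smul continuous_const)
  have : Measurable fun z : normalPlane ν × ℝ => G (graphMap ν γ z.1 + z.2 • ν) :=
    hG.comp hcont.measurable
  exact this.lintegral_prod_right'

/-- Local trace inequality. -/
theorem exists_trace_le (H : IsLocalEpigraph Ω S x₀ ν γ r) (hx₀ : x₀ ∈ S)
    (hΩ : MeasurableSet Ω) :
    ∃ ρ > 0, ∃ C : ℝ≥0∞, C ≠ ⊤ ∧ ∀ φ : EuclideanSpace ℝ (Fin d) → ℝ, ContDiff ℝ ∞ φ →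
      ∫⁻ x, ‖φ x‖ₑ ^ 2 ∂surfaceMeasure (S ∩ Metric.ball x₀ ρ)
        ≤ C * ((∫⁻ x in Ω, ‖φ x‖ₑ ^ 2) + ∫⁻ x in Ω, ‖∇ φ x‖ₑ ^ 2) := by
  obtain ⟨ρ, hρ, K, hK, hD⟩ := H.exists_disc hx₀
  obtain ⟨c, -, hc⟩ := exists_lintegral_graph H.norm_eq (γ := γ)
  have hγ := H.contDiff.continuous
  have hh : 0 < r / 2 := half_pos H.pos
  set h := r / 2 with hhdef
  set η := ENNReal.ofReal h
  have hη0 : η ≠ 0 := by simpa [η] using hh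
  have hηt : η ≠ ⊤ := ENNReal.ofReal_ne_top
  set D := Metric.ball (planeProj ν x₀) ρ
  -- Radius: `ρ` makes projections land in the disc and `r` makes the graph equation available.
  -- Constant: `K ^ (d - 1)` comes from the graph map, `η⁻¹` from averaging over the columns, `c`
  -- from the coordinates.
  refine ⟨min ρ r, lt_min hρ H.pos, (K : ℝ≥0∞) ^ (d - 1) * (η⁻¹ * (2 * c + 2 * η ^ 2 * c)),
    by finiteness, fun φ hφ => ?_⟩
  have hg : Measurable fun x => ‖∇ φ x‖ₑ ^ 2 :=
    (continuous_gradient_of_contDiff hφ).enorm.measurable.pow_const 2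
  have hf : Measurable fun x => ‖φ x‖ₑ ^ 2 := hφ.continuous.enorm.measurable.pow_const 2
  have hgr := (continuous_graphMap (ν := ν) hγ).measurable
  have hfg : Measurable fun y => ‖φ (graphMap ν γ y)‖ₑ ^ 2 := hf.comp hgr
  have hsub : S ∩ Metric.ball x₀ (min ρ r) ⊆ graphMap ν γ '' D := by
    rintro x ⟨hxS, hx⟩
    refine ⟨planeProj ν x, ?_, ?_⟩
    · rw [Metric.mem_ball, dist_eq_norm, ← map_sub]
      refine (Submodule.norm_orthogonalProjectionOnto_apply_le _ _).trans_lt ?_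
      rw [← dist_eq_norm]
      exact lt_of_lt_of_le hx (min_le_left _ _)
    · rw [graphMap, (H.boundary_iff x (Metric.ball_subset_ball (min_le_right _ _) hx)).1 hxS,
        planeProj_add_inner_smul H.norm_eq]
  set m : Measure (normalPlane ν) := Measure.euclideanHausdorffMeasure (d - 1)
  have h1 : ∫⁻ x, ‖φ x‖ₑ ^ 2 ∂surfaceMeasure (S ∩ Metric.ball x₀ (min ρ r))
      ≤ (K : ℝ≥0∞) ^ (d - 1) * ∫⁻ y in D, ‖φ (graphMap ν γ y)‖ₑ ^ 2 ∂m := by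
    refine (lintegral_mono' (le_map_graphMap hγ hK hsub) le_rfl).trans_eq ?_
    rw [lintegral_smul_measure, smul_eq_mul, lintegral_map hf hgr]
  have h2 : η * ∫⁻ y in D, ‖φ (graphMap ν γ y)‖ₑ ^ 2 ∂m
      ≤ 2 * (c * ∫⁻ x in Ω, ‖φ x‖ₑ ^ 2) + 2 * η ^ 2 * (c * ∫⁻ x in Ω, ‖∇ φ x‖ₑ ^ 2) := by
    rw [← lintegral_const_mul _ hfg]
    refine (lintegral_mono fun y => enorm_sq_le_column hφ H.norm_eq hh (graphMap ν γ y)).trans ?_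
    rw [lintegral_add_left ((measurable_column hγ h hf).const_mul _),
      lintegral_const_mul _ (measurable_column hγ h hf),
      lintegral_const_mul _ (measurable_column hγ h hg)]
    refine add_le_add (mul_le_mul_right ?_ _) (mul_le_mul_right ?_ _)
    · exact lintegral_columns_le hΩ hc measurableSet_ball (fun y hy => (hD y hy).2) hf
    · exact lintegral_columns_le hΩ hc measurableSet_ball (fun y hy => (hD y hy).2) hg
  set X := ∫⁻ x in Ω, ‖φ x‖ₑ ^ 2
  set Y := ∫⁻ x in Ω, ‖∇ φ x‖ₑ ^ 2
  refine h1.trans ?_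
  rw [mul_assoc]
  refine mul_le_mul_right ?_ _
  rw [mul_assoc, ← ENNReal.div_eq_inv_mul, ENNReal.le_div_iff_mul_le (Or.inl hη0) (Or.inl hηt),
    mul_comm]
  refine h2.trans ?_
  calc 2 * (c * X) + 2 * η ^ 2 * (c * Y) ≤ 2 * (c * (X + Y)) + 2 * η ^ 2 * (c * (X + Y)) := by
        gcongr <;> simp
    _ = _ := by ring

/-- Near a boundary point there is a ball on which the `L²`-norm is controlled by the boundary
values and the gradient. -/
theorem exists_ball_le (H : IsLocalEpigraph Ω S x₀ ν γ r) (hx₀ : x₀ ∈ S)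
    (hΩ : MeasurableSet Ω) :
    ∃ x₁, ∃ δ > 0, Metric.ball x₁ δ ⊆ Ω ∧ ∃ C : ℝ≥0∞, C ≠ ⊤ ∧
      ∀ φ : EuclideanSpace ℝ (Fin d) → ℝ, ContDiff ℝ ∞ φ →
        ∫⁻ x in Metric.ball x₁ δ, ‖φ x‖ₑ ^ 2
        ≤ C * ((∫⁻ x, ‖φ x‖ₑ ^ 2 ∂surfaceMeasure S) + ∫⁻ x in Ω, ‖∇ φ x‖ₑ ^ 2) := by
  obtain ⟨ρ, hρ, K, hK, hD⟩ := H.exists_disc hx₀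
  obtain ⟨c, hc0, hc⟩ := exists_lintegral_graph H.norm_eq (γ := γ)
  have hγ := H.contDiff.continuous
  have hh : 0 < r / 2 := half_pos H.pos
  set h := r / 2 with hhdef
  set η := ENNReal.ofReal h
  have hηt : η ≠ ⊤ := ENNReal.ofReal_ne_top
  set D := Metric.ball (planeProj ν x₀) ρ
  -- `Z` is the open cylinder formed by the columns of height `h` over the disc. The estimate is
  -- proved on all of `Z` and then restricted to a ball inside it.
  set Z : Set (EuclideanSpace ℝ (Fin d)) :=
    {x | planeProj ν x ∈ D} ∩ {x | inner ℝ ν x - γ (planeProj ν x) ∈ Set.Ioo 0 h} with hZ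
  have hZo : IsOpen Z := by
    refine (Metric.isOpen_ball.preimage (planeProj ν).continuous).inter
      (isOpen_Ioo.preimage ?_)
    exact (continuous_const.inner continuous_id).sub
      (hγ.comp (continuous_subtype_val.comp (planeProj ν).continuous))
  have hinner : ∀ (y : normalPlane ν) (s : ℝ),
      inner ℝ ν (graphMap ν γ y + s • ν) = γ y + s := fun y s => by
    rw [graphMap, add_assoc, ← add_smul, inner_add_smul H.norm_eq]
  have hproj : ∀ (y : normalPlane ν) (s : ℝ), planeProj ν (graphMap ν γ y + s • ν) = y :=
    fun y s => by rw [graphMap, add_assoc, ← add_smul, planeProj_add_smul H.norm_eq]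
  have hZmem : ∀ y s, graphMap ν γ y + s • ν ∈ Z → y ∈ D ∧ s ∈ Set.Ioo 0 h := by
    rintro y s ⟨h1, h2⟩
    simp only [Set.mem_ofPred_eq, hproj, hinner, add_sub_cancel_left] at h1 h2
    exact ⟨h1, h2⟩
  have hx₁ : graphMap ν γ (planeProj ν x₀) + (h / 2) • ν ∈ Z := by
    constructor
    · rw [Set.mem_ofPred_eq, hproj]; exact Metric.mem_ball_self hρ
    · rw [Set.mem_ofPred_eq, hproj, hinner, add_sub_cancel_left]
      exact ⟨half_pos hh, half_lt_self hh⟩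
  have hZΩ : Z ⊆ Ω := by
    rintro x ⟨h1, h2⟩
    have := (hD _ h1).2 _ h2
    rwa [graphMap, add_assoc, ← add_smul, add_sub_cancel,
      planeProj_add_inner_smul H.norm_eq] at this
  obtain ⟨δ, hδ, hball⟩ := Metric.isOpen_iff.1 hZo _ hx₁
  refine ⟨_, δ, hδ, hball.trans hZΩ, (c : ℝ≥0∞)⁻¹ * (2 * η + 2 * η ^ 2 * c),
    by finiteness [ENNReal.inv_ne_top.2 (ENNReal.coe_ne_zero.2 hc0)], fun φ hφ => ?_⟩
  have hg : Measurable fun x => ‖∇ φ x‖ₑ ^ 2 :=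
    (continuous_gradient_of_contDiff hφ).enorm.measurable.pow_const 2
  have hf : Measurable fun x => ‖φ x‖ₑ ^ 2 := hφ.continuous.enorm.measurable.pow_const 2
  have hgr := (continuous_graphMap (ν := ν) hγ).measurable
  have hfg : Measurable fun y => ‖φ (graphMap ν γ y)‖ₑ ^ 2 := hf.comp hgr
  set m : Measure (normalPlane ν) := Measure.euclideanHausdorffMeasure (d - 1)
  refine (lintegral_mono_set hball).trans ?_
  have h1 : ∫⁻ y in D, ‖φ (graphMap ν γ y)‖ₑ ^ 2 ∂m ≤ ∫⁻ x, ‖φ x‖ₑ ^ 2 ∂surfaceMeasure S := by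
    rw [← lintegral_map hf hgr]
    exact lintegral_mono' (map_graphMap_le H.norm_eq hγ fun y hy => (hD y hy).1) le_rfl
  have h2 : c * ∫⁻ x in Z, ‖φ x‖ₑ ^ 2 ≤ 2 * η * (∫⁻ x, ‖φ x‖ₑ ^ 2 ∂surfaceMeasure S)
      + 2 * η ^ 2 * (c * ∫⁻ x in Ω, ‖∇ φ x‖ₑ ^ 2) := by
    refine (le_lintegral_columns hZo.measurableSet hc measurableSet_ball hZmem hf).trans ?_
    refine (lintegral_mono fun y => column_le_enorm_sq hφ H.norm_eq hh (graphMap ν γ y)).trans ?_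
    rw [lintegral_add_left (hfg.const_mul _),
      lintegral_const_mul _ hfg,
      lintegral_const_mul _ (measurable_column hγ h hg)]
    refine add_le_add (mul_le_mul_right h1 _) (mul_le_mul_right ?_ _)
    exact lintegral_columns_le hΩ hc measurableSet_ball (fun y hy => (hD y hy).2) hg
  set X := ∫⁻ x, ‖φ x‖ₑ ^ 2 ∂surfaceMeasure S
  set Y := ∫⁻ x in Ω, ‖∇ φ x‖ₑ ^ 2
  rw [mul_assoc, ← ENNReal.div_eq_inv_mul,
    ENNReal.le_div_iff_mul_le (Or.inl (ENNReal.coe_ne_zero.2 hc0)) (Or.inl ENNReal.coe_ne_top),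
    mul_comm]
  refine h2.trans ?_
  calc 2 * η * X + 2 * η ^ 2 * (c * Y) ≤ 2 * η * (X + Y) + 2 * η ^ 2 * (c * (X + Y)) := by
        gcongr <;> simp
    _ = _ := by ring

/-- Near a boundary point, `Ω` can be translated into a compact part of itself. -/
theorem exists_translation (H : IsLocalEpigraph Ω S x₀ ν γ r) :
    ∃ ρ > 0, ∃ w : EuclideanSpace ℝ (Fin d), ∃ K ⊆ Ω, IsCompact K ∧
      ∀ x ∈ Ω ∩ Metric.ball x₀ ρ, x + w ∈ K ∧ ∀ t ∈ Set.Ioo (0 : ℝ) 1, x + t • w ∈ Ω := by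
  have hr := H.pos
  have hγ := H.contDiff.continuous
  -- The non-strict inequality admits boundary points: any positive upward shift puts them inside
  -- `Ω`, and `r / 4 + r / 2 < r` keeps them in the chart.
  have hmove : ∀ x ∈ Metric.closedBall x₀ (r / 4), γ (planeProj ν x) ≤ inner ℝ ν x →
      ∀ s ∈ Set.Ioc 0 (r / 2), x + s • ν ∈ Ω := by
    intro x hx hle s hs
    rw [H.mem_iff, planeProj_translate H.norm_eq, inner_translate H.norm_eq]
    · linarith [hs.1]
    · rw [Metric.mem_closedBall, dist_eq_norm] at hx
      rw [Metric.mem_ball, dist_eq_norm]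
      calc ‖x + s • ν - x₀‖ = ‖(x - x₀) + s • ν‖ := by congr 1; abel
        _ ≤ ‖x - x₀‖ + ‖s • ν‖ := norm_add_le _ _
        _ ≤ r / 4 + r / 2 := by
          rw [norm_smul, H.norm_eq, mul_one, Real.norm_of_nonneg hs.1.le]
          exact add_le_add hx hs.2
        _ < r := by linarith
  -- `K` is the shift of a closed piece of the epigraph including its boundary, which is what makes
  -- it compact and still contained in `Ω`.
  refine ⟨r / 4, by linarith, (r / 2) • ν, (fun x => x + (r / 2) • ν) ''
    (Metric.closedBall x₀ (r / 4) ∩ {x | γ (planeProj ν x) ≤ inner ℝ ν x}), ?_, ?_, ?_⟩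
  · rintro _ ⟨x, ⟨hx, hle⟩, rfl⟩
    exact hmove x hx hle _ ⟨by linarith, le_rfl⟩
  · refine ((isCompact_closedBall _ _).inter_right (isClosed_le ?_ ?_)).image (by fun_prop)
    · exact hγ.comp (continuous_subtype_val.comp (planeProj ν).continuous)
    · exact continuous_const.inner continuous_id
  · rintro x ⟨hxΩ, hx⟩
    have hle : γ (planeProj ν x) ≤ inner ℝ ν x :=
      ((H.mem_iff x (Metric.ball_subset_ball (by linarith) hx)).1 hxΩ).le
    refine ⟨⟨x, ⟨Metric.ball_subset_closedBall hx, hle⟩, rfl⟩, fun t ht => ?_⟩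
    rw [smul_smul]
    exact hmove x (Metric.ball_subset_closedBall hx) hle _
      ⟨by nlinarith [ht.1], by nlinarith [ht.2]⟩

end IsLocalEpigraph

end

/-! ### Global trace and Poincaré inequalities for smooth functions -/

section

variable {d : ℕ}

theorem setLIntegral_union_le {α : Type*} [MeasurableSpace α] (μ : Measure α) (f : α → ℝ≥0∞)
    (s t : Set α) : ∫⁻ x in s ∪ t, f x ∂μ ≤ (∫⁻ x in s, f x ∂μ) + ∫⁻ x in t, f x ∂μ := by
  rw [← lintegral_add_measure]
  exact lintegral_mono' (Measure.restrict_union_le s t) le_rfl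

/-- Trace inequality for smooth functions on a compact part of the boundary. -/
theorem exists_trace_le_of_isCompact {Ω S : Set (EuclideanSpace ℝ (Fin d))} (hΩ : IsOpen Ω)
    (hS : IsCompact S) (hloc : ∀ x₀ ∈ S, ∃ ν γ r, IsLocalEpigraph Ω S x₀ ν γ r) :
    ∃ C : ℝ≥0∞, C ≠ ⊤ ∧ ∀ φ : EuclideanSpace ℝ (Fin d) → ℝ, ContDiff ℝ ∞ φ →
      ∫⁻ x, ‖φ x‖ₑ ^ 2 ∂surfaceMeasure S
        ≤ C * ((∫⁻ x in Ω, ‖φ x‖ₑ ^ 2) + ∫⁻ x in Ω, ‖∇ φ x‖ₑ ^ 2) := by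
  -- Writing `S ∩ S` separates the surface from the set over which compactness induction runs.
  have key : ∃ C : ℝ≥0∞, C ≠ ⊤ ∧ ∀ φ : EuclideanSpace ℝ (Fin d) → ℝ, ContDiff ℝ ∞ φ →
      ∫⁻ x, ‖φ x‖ₑ ^ 2 ∂surfaceMeasure (S ∩ S)
        ≤ C * ((∫⁻ x in Ω, ‖φ x‖ₑ ^ 2) + ∫⁻ x in Ω, ‖∇ φ x‖ₑ ^ 2) := by
    refine hS.induction_on (p := fun s => ∃ C : ℝ≥0∞, C ≠ ⊤ ∧
      ∀ φ : EuclideanSpace ℝ (Fin d) → ℝ, ContDiff ℝ ∞ φ →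
      ∫⁻ x, ‖φ x‖ₑ ^ 2 ∂surfaceMeasure (S ∩ s)
        ≤ C * ((∫⁻ x in Ω, ‖φ x‖ₑ ^ 2) + ∫⁻ x in Ω, ‖∇ φ x‖ₑ ^ 2)) ?_ ?_ ?_ ?_
    · exact ⟨0, by simp, fun φ _ => by simp⟩
    · rintro s t hst ⟨C, hC, h⟩
      exact ⟨C, hC, fun φ hφ => (lintegral_mono_set (Set.inter_subset_inter_right S hst)).trans
        (h φ hφ)⟩
    · rintro s t ⟨C, hC, h⟩ ⟨C', hC', h'⟩
      refine ⟨C + C', by finiteness, fun φ hφ => ?_⟩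
      rw [Set.inter_union_distrib_left, add_mul]
      exact (setLIntegral_union_le _ _ _ _).trans (add_le_add (h φ hφ) (h' φ hφ))
    · intro x hx
      obtain ⟨ν, γ, r, H⟩ := hloc x hx
      obtain ⟨ρ, hρ, C, hC, h⟩ := H.exists_trace_le hx hΩ.measurableSet
      exact ⟨Metric.ball x ρ, mem_nhdsWithin_of_mem_nhds (Metric.ball_mem_nhds x hρ), C, hC, h⟩
  simpa only [Set.inter_self] using key

/-- On `A`, the `L²`-norm of smooth functions is controlled by the boundary values on `S` and by
the gradient on `Ω`. -/
def IsControlled (Ω S A : Set (EuclideanSpace ℝ (Fin d))) : Prop :=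
  ∃ C : ℝ≥0∞, C ≠ ⊤ ∧ ∀ φ : EuclideanSpace ℝ (Fin d) → ℝ, ContDiff ℝ ∞ φ →
    ∫⁻ x in A, ‖φ x‖ₑ ^ 2
      ≤ C * ((∫⁻ x, ‖φ x‖ₑ ^ 2 ∂surfaceMeasure S) + ∫⁻ x in Ω, ‖∇ φ x‖ₑ ^ 2)

namespace IsControlled

variable {Ω S A B : Set (EuclideanSpace ℝ (Fin d))}

theorem mono (h : IsControlled Ω S B) (hAB : A ⊆ B) : IsControlled Ω S A := by
  obtain ⟨C, hC, h⟩ := h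
  exact ⟨C, hC, fun φ hφ => (lintegral_mono_set hAB).trans (h φ hφ)⟩

theorem empty : IsControlled Ω S ∅ := ⟨0, by simp, fun φ _ => by simp⟩

theorem union (hA : IsControlled Ω S A) (hB : IsControlled Ω S B) :
    IsControlled Ω S (A ∪ B) := by
  obtain ⟨C, hC, h⟩ := hA
  obtain ⟨C', hC', h'⟩ := hB
  refine ⟨C + C', by finiteness, fun φ hφ => ?_⟩
  rw [add_mul]
  exact (setLIntegral_union_le _ _ _ _).trans (add_le_add (h φ hφ) (h' φ hφ))

/-- The mechanism that propagates control: it passes from `B` back to any set that can be slid into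
`B` along segments in `Ω`. -/
theorem translate (hB : IsControlled Ω S B) (w : EuclideanSpace ℝ (Fin d))
    (hAm : MeasurableSet A) (hΩ : MeasurableSet Ω) (hBm : MeasurableSet B)
    (hseg : ∀ x ∈ A, ∀ t ∈ Set.Ioo (0 : ℝ) 1, x + t • w ∈ Ω) (hAB : ∀ x ∈ A, x + w ∈ B) :
    IsControlled Ω S A := by
  obtain ⟨C, hC, h⟩ := hB
  refine ⟨2 * C + 2 * ‖w‖ₑ ^ 2, by finiteness, fun φ hφ => ?_⟩
  refine (lintegral_sq_le_translate w hAm hΩ hBm hseg hAB hφ).trans ?_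
  rw [add_mul, mul_assoc 2 C]
  exact add_le_add (mul_le_mul_right (h φ hφ) _) (mul_le_mul_right le_add_self _)

/-- If one ball in a connected open set is controlled, then every point of it has a controlled
neighbourhood. -/
theorem exists_ball (hΩ : IsOpen Ω) (hc : IsPreconnected Ω) {x₁ : EuclideanSpace ℝ (Fin d)}
    {δ₁ : ℝ} (hδ₁ : 0 < δ₁) (hsub : Metric.ball x₁ δ₁ ⊆ Ω)
    (h₁ : IsControlled Ω S (Metric.ball x₁ δ₁)) {x : EuclideanSpace ℝ (Fin d)} (hx : x ∈ Ω) :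
    ∃ δ > 0, IsControlled Ω S (Metric.ball x δ) := by
  set O : Set (EuclideanSpace ℝ (Fin d)) :=
    {x | ∃ δ > 0, IsControlled Ω S (Metric.ball x δ)} with hO
  have hOopen : IsOpen O := by
    rw [Metric.isOpen_iff]
    rintro y ⟨δ, hδ, h⟩
    refine ⟨δ / 2, half_pos hδ, fun z hz => ⟨δ / 2, half_pos hδ, h.mono ?_⟩⟩
    refine Metric.ball_subset_ball' ?_
    rw [Metric.mem_ball] at hz
    linarith
  -- `O` is open and, as shown next, relatively closed in `Ω`; connectedness then gives `Ω ⊆ O`.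
  refine hc.subset_of_closure_inter_subset hOopen
    ⟨x₁, hsub (Metric.mem_ball_self hδ₁), δ₁, hδ₁, h₁⟩ ?_ hx
  rintro z ⟨hz, hzΩ⟩
  obtain ⟨ε, hε, hball⟩ := Metric.isOpen_iff.1 hΩ z hzΩ
  obtain ⟨y, ⟨δ, hδ, h⟩, hyz⟩ := Metric.mem_closure_iff.1 hz (ε / 2) (half_pos hε)
  -- Shift by `y - z`: radius at most `δ` makes the ball land in the controlled ball at `y`, and
  -- radius at most `ε / 2` keeps the segments in `ball z ε ⊆ Ω`.
  refine ⟨min δ (ε / 2), lt_min hδ (half_pos hε), h.translate (y - z) measurableSet_ball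
    hΩ.measurableSet measurableSet_ball (fun a ha t ht => hball ?_) (fun a ha => ?_)⟩
  · rw [Metric.mem_ball, dist_eq_norm] at ha ⊢
    rw [dist_comm, dist_eq_norm] at hyz
    calc ‖a + t • (y - z) - z‖ = ‖(a - z) + t • (y - z)‖ := by congr 1; abel
      _ ≤ ‖a - z‖ + ‖t • (y - z)‖ := norm_add_le _ _
      _ < ε / 2 + ε / 2 := by
        refine add_lt_add (lt_of_lt_of_le ha (min_le_right _ _)) ?_
        rw [norm_smul, Real.norm_of_nonneg ht.1.le]
        nlinarith [ht.2, norm_nonneg (y - z)]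
      _ = ε := by ring
  · rw [Metric.mem_ball, dist_eq_norm] at ha ⊢
    have : a + (y - z) - y = a - z := by abel
    rw [this]
    exact lt_of_lt_of_le ha (min_le_left _ _)

/-- Control is inherited by subsets and finite unions, so local control suffices on a compact set.
-/
theorem of_isCompact {K : Set (EuclideanSpace ℝ (Fin d))} (hK : IsCompact K)
    (h : ∀ x ∈ K, ∃ δ > 0, IsControlled Ω S (A ∩ Metric.ball x δ)) :
    IsControlled Ω S (A ∩ K) := by
  refine hK.induction_on (p := fun s => IsControlled Ω S (A ∩ s)) ?_ ?_ ?_ ?_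
  · simpa using empty
  · intro s t hst ht
    exact ht.mono (Set.inter_subset_inter_right A hst)
  · intro s t hs ht
    rw [Set.inter_union_distrib_left]
    exact hs.union ht
  · intro x hx
    obtain ⟨δ, hδ, h⟩ := h x hx
    exact ⟨_, mem_nhdsWithin_of_mem_nhds (Metric.ball_mem_nhds x hδ), h⟩

end IsControlled

/-- Poincaré inequality for smooth functions on a bounded connected open set with local epigraph
boundary, in terms of the boundary values on a part `S` of the boundary. -/
theorem exists_poincare {Ω S : Set (EuclideanSpace ℝ (Fin d))} (hΩ : IsOpen Ω)
    (hc : IsPreconnected Ω) (hb : Bornology.IsBounded Ω)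
    (hloc : ∀ x₀ ∈ frontier Ω, ∃ S' ν γ r, IsLocalEpigraph Ω S' x₀ ν γ r)
    (hS : ∃ x₀ ∈ S, ∃ ν γ r, IsLocalEpigraph Ω S x₀ ν γ r) :
    IsControlled Ω S Ω := by
  obtain ⟨x₀, hx₀, ν, γ, r, H⟩ := hS
  obtain ⟨x₁, δ₁, hδ₁, hsub, h₁⟩ := H.exists_ball_le hx₀ hΩ.measurableSet
  have hball : ∀ x ∈ Ω, ∃ δ > 0, IsControlled Ω S (Metric.ball x δ) := fun x hx =>
    IsControlled.exists_ball hΩ hc hδ₁ hsub h₁ hx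
  have hcl : IsControlled Ω S (Ω ∩ closure Ω) := by
    refine IsControlled.of_isCompact hb.isCompact_closure fun x hx => ?_
    by_cases hxΩ : x ∈ Ω
    · obtain ⟨δ, hδ, h⟩ := hball x hxΩ
      exact ⟨δ, hδ, h.mono Set.inter_subset_right⟩
    · obtain ⟨S', ν, γ, r, H'⟩ := hloc x (by rw [hΩ.frontier_eq]; exact ⟨hx, hxΩ⟩)
      -- At a frontier point, the nearby part of `Ω` is pushed inward into a compact `K ⊆ Ω`, and
      -- finitely many controlled balls cover `K`.
      obtain ⟨ρ, hρ, w, K, hKΩ, hK, h⟩ := H'.exists_translation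
      have hKc : IsControlled Ω S (Set.univ ∩ K) :=
        IsControlled.of_isCompact hK fun y hy => by
          obtain ⟨δ, hδ, h⟩ := hball y (hKΩ hy)
          exact ⟨δ, hδ, h.mono Set.inter_subset_right⟩
      rw [Set.univ_inter] at hKc
      exact ⟨ρ, hρ, hKc.translate w (hΩ.inter Metric.isOpen_ball).measurableSet hΩ.measurableSet
        hK.measurableSet (fun y hy => (h y hy).2) (fun y hy => (h y hy).1)⟩
  exact hcl.mono fun x hx => ⟨hx, subset_closure hx⟩

/-! ### Boundary charts of the annular domain -/

section Domain

variable {U : Set (EuclideanSpace ℝ (Fin d))} {x₀ ν : EuclideanSpace ℝ (Fin d)}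
  {γ : EuclideanSpace ℝ (Fin d) → ℝ} {r : ℝ}

/-- Points strictly below the graph have a neighbourhood missing `U`; points on or above it are
limits of `x + s • ν` as `s ↓ 0`, which lie in `U`. -/
theorem mem_closure_iff_of_epigraph (hν : ‖ν‖ = 1) (hγ : Continuous γ)
    (h : ∀ x ∈ Metric.ball x₀ r, (x ∈ U ↔ γ (x - inner ℝ ν x • ν) < inner ℝ ν x))
    {x : EuclideanSpace ℝ (Fin d)} (hx : x ∈ Metric.ball x₀ r) :
    x ∈ closure U ↔ γ (x - inner ℝ ν x • ν) ≤ inner ℝ ν x := by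
  have hi : Continuous fun x : EuclideanSpace ℝ (Fin d) => inner ℝ ν x :=
    continuous_const.inner continuous_id
  have hg : Continuous fun x : EuclideanSpace ℝ (Fin d) => γ (x - inner ℝ ν x • ν) :=
    hγ.comp (continuous_id.sub (hi.smul continuous_const))
  constructor
  · intro hcl
    by_contra! hlt
    have hopen : IsOpen (Metric.ball x₀ r ∩
        {x | inner ℝ ν x < γ (x - inner ℝ ν x • ν)}) :=
      Metric.isOpen_ball.inter (isOpen_lt hi hg)
    obtain ⟨z, ⟨hz1, hz2⟩, hzU⟩ := mem_closure_iff.1 hcl _ hopen ⟨hx, hlt⟩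
    exact absurd ((h z hz1).1 hzU) (not_lt.2 (le_of_lt hz2))
  · intro hle
    have ht : Tendsto (fun s : ℝ => x + s • ν) (𝓝[>] 0) (𝓝 x) := by
      have : Continuous fun s : ℝ => x + s • ν := by fun_prop
      have h0 := this.tendsto 0
      rw [zero_smul, add_zero] at h0
      exact h0.mono_left nhdsWithin_le_nhds
    refine mem_closure_of_tendsto ht ?_
    filter_upwards [ht.eventually (Metric.isOpen_ball.mem_nhds hx), self_mem_nhdsWithin]
      with s hs hs0
    have e : x + s • ν - inner ℝ ν (x + s • ν) • ν = x - inner ℝ ν x • ν := by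
      rw [inner_translate hν]; module
    rw [h _ hs, e, inner_translate hν]
    linarith [Set.mem_Ioi.1 hs0]

theorem mem_frontier_iff_of_epigraph (hU : IsOpen U) (hν : ‖ν‖ = 1) (hγ : Continuous γ)
    (h : ∀ x ∈ Metric.ball x₀ r, (x ∈ U ↔ γ (x - inner ℝ ν x • ν) < inner ℝ ν x))
    {x : EuclideanSpace ℝ (Fin d)} (hx : x ∈ Metric.ball x₀ r) :
    x ∈ frontier U ↔ γ (x - inner ℝ ν x • ν) = inner ℝ ν x := by
  rw [hU.frontier_eq, Set.mem_sdiff, mem_closure_iff_of_epigraph hν hγ h hx, h x hx, not_lt,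
    le_antisymm_iff]

/-- A set agreeing with a `C³` domain near a boundary point. -/
theorem IsBoundedC3Domain.isLocalEpigraph (hU : IsBoundedC3Domain U) (hx₀ : x₀ ∈ frontier U)
    {Ω : Set (EuclideanSpace ℝ (Fin d))} (hΩ : ∀ᶠ x in 𝓝 x₀, x ∈ Ω ↔ x ∈ U) :
    ∃ ν γ r, IsLocalEpigraph Ω (frontier U) x₀ ν γ r := by
  obtain ⟨r, hr, ν, hν, γ, hγ, h⟩ := hU.boundary x₀ hx₀
  obtain ⟨ε, hε, hball⟩ := Metric.eventually_nhds_iff_ball.1 hΩ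
  refine ⟨ν, γ, min r ε, lt_min hr hε, hν, hγ.of_le (by norm_num), fun x hx => ?_, fun x hx => ?_⟩
  · rw [hball x (Metric.ball_subset_ball (min_le_right _ _) hx),
      h x (Metric.ball_subset_ball (min_le_left _ _) hx), coe_planeProj hν]
  · rw [mem_frontier_iff_of_epigraph hU.isOpen hν hγ.continuous h
      (Metric.ball_subset_ball (min_le_left _ _) hx), coe_planeProj hν]

/-- A set agreeing with the exterior of a `C³` domain near a boundary point. -/
theorem IsBoundedC3Domain.isLocalEpigraph_exterior (hU : IsBoundedC3Domain U)
    (hx₀ : x₀ ∈ frontier U) {Ω : Set (EuclideanSpace ℝ (Fin d))}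
    (hΩ : ∀ᶠ x in 𝓝 x₀, x ∈ Ω ↔ x ∉ closure U) :
    ∃ ν γ r, IsLocalEpigraph Ω (frontier U) x₀ ν γ r := by
  obtain ⟨r, hr, ν, hν, γ, hγ, h⟩ := hU.boundary x₀ hx₀
  obtain ⟨ε, hε, hball⟩ := Metric.eventually_nhds_iff_ball.1 hΩ
  have hν' : ‖-ν‖ = 1 := by rw [norm_neg, hν]
  -- The strict region below a graph is the strict epigraph of `-γ` in direction `-ν`; the
  -- projection does not change with the sign of `ν`.
  refine ⟨-ν, fun x => -γ x, min r ε, lt_min hr hε, hν', (hγ.of_le (by norm_num)).neg,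
    fun x hx => ?_, fun x hx => ?_⟩
  · rw [hball x (Metric.ball_subset_ball (min_le_right _ _) hx),
      mem_closure_iff_of_epigraph hν hγ.continuous h
        (Metric.ball_subset_ball (min_le_left _ _) hx), coe_planeProj hν', inner_neg_left,
      neg_smul_neg, neg_lt_neg_iff, not_le]
  · rw [mem_frontier_iff_of_epigraph hU.isOpen hν hγ.continuous h
      (Metric.ball_subset_ball (min_le_left _ _) hx), coe_planeProj hν', inner_neg_left,
      neg_smul_neg, neg_inj]

end Domain

section Annular

variable {Ω₁ Ω₂ : Set (EuclideanSpace ℝ (Fin d))}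

theorem exists_isLocalEpigraph_inner (hΩ₁ : IsBoundedC3Domain Ω₁) (hΩ₂ : IsBoundedC3Domain Ω₂)
    (hsub : closure Ω₁ ⊆ Ω₂) {x₀ : EuclideanSpace ℝ (Fin d)} (hx₀ : x₀ ∈ frontier Ω₁) :
    ∃ ν γ r, IsLocalEpigraph (Ω₂ \ closure Ω₁) (frontier Ω₁) x₀ ν γ r := by
  refine hΩ₁.isLocalEpigraph_exterior hx₀ ?_
  filter_upwards [hΩ₂.isOpen.mem_nhds (hsub (frontier_subset_closure hx₀))] with x hx
  simp [hx]

theorem exists_isLocalEpigraph_outer (hΩ₂ : IsBoundedC3Domain Ω₂)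
    (hsub : closure Ω₁ ⊆ Ω₂) {x₀ : EuclideanSpace ℝ (Fin d)} (hx₀ : x₀ ∈ frontier Ω₂) :
    ∃ ν γ r, IsLocalEpigraph (Ω₂ \ closure Ω₁) (frontier Ω₂) x₀ ν γ r := by
  refine hΩ₂.isLocalEpigraph hx₀ ?_
  have h0 : x₀ ∉ closure Ω₁ := fun h => by
    rw [hΩ₂.isOpen.frontier_eq] at hx₀
    exact hx₀.2 (hsub h)
  filter_upwards [isClosed_closure.isOpen_compl.mem_nhds h0] with x hx
  simp only [Set.mem_sdiff, and_iff_left_iff_imp]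
  exact fun _ => hx

/-- A non-empty set without frontier is the whole space, which is unbounded in positive dimension.
-/
theorem frontier_nonempty (hd : 1 ≤ d) (hΩ₂ : IsBoundedC3Domain Ω₂) :
    (frontier Ω₂).Nonempty := by
  have : Nonempty (Fin d) := ⟨⟨0, hd⟩⟩
  refine nonempty_frontier_iff.2 ⟨hΩ₂.isConnected.nonempty, fun h => ?_⟩
  have hb := hΩ₂.isBounded
  rw [h] at hb
  exact NormedSpace.unbounded_univ ℝ (EuclideanSpace ℝ (Fin d)) hb

theorem exists_poincare_annular (hd : 1 ≤ d) (hΩ₁ : IsBoundedC3Domain Ω₁)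
    (hΩ₂ : IsBoundedC3Domain Ω₂) (hsub : closure Ω₁ ⊆ Ω₂)
    (hconn : IsConnected (Ω₂ \ closure Ω₁)) :
    IsControlled (Ω₂ \ closure Ω₁) (frontier Ω₂) (Ω₂ \ closure Ω₁) := by
  refine exists_poincare (hΩ₂.isOpen.sdiff isClosed_closure) hconn.isPreconnected
    (hΩ₂.isBounded.subset Set.sdiff_subset) (fun x hx => ?_) ?_
  · rw [Set.sdiff_eq] at hx
    rcases frontier_inter_subset _ _ hx with ⟨h, -⟩ | ⟨-, h⟩
    · exact ⟨_, exists_isLocalEpigraph_outer hΩ₂ hsub h⟩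
    · rw [frontier_compl] at h
      exact ⟨_, exists_isLocalEpigraph_inner hΩ₁ hΩ₂ hsub (frontier_closure_subset h)⟩
  · obtain ⟨x, hx⟩ := frontier_nonempty hd hΩ₂
    exact ⟨x, hx, exists_isLocalEpigraph_outer hΩ₂ hsub hx⟩

theorem exists_trace_le_annular (hΩ₁ : IsBoundedC3Domain Ω₁)
    (hΩ₂ : IsBoundedC3Domain Ω₂) (hsub : closure Ω₁ ⊆ Ω₂) :
    ∃ C : ℝ≥0∞, C ≠ ⊤ ∧ ∀ φ : EuclideanSpace ℝ (Fin d) → ℝ, ContDiff ℝ ∞ φ →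
      ∫⁻ x, ‖φ x‖ₑ ^ 2 ∂surfaceMeasure (frontier Ω₁)
        ≤ C * ((∫⁻ x in Ω₂ \ closure Ω₁, ‖φ x‖ₑ ^ 2)
          + ∫⁻ x in Ω₂ \ closure Ω₁, ‖∇ φ x‖ₑ ^ 2) :=
  exists_trace_le_of_isCompact (hΩ₂.isOpen.sdiff isClosed_closure)
    (Metric.isCompact_of_isClosed_isBounded isClosed_frontier
      (hΩ₁.isBounded.closure.subset frontier_subset_closure))
    fun _ hx => exists_isLocalEpigraph_inner hΩ₁ hΩ₂ hsub hx

end Annular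

end

/-! ### Passage from smooth functions to `H¹` -/

section

variable {d : ℕ}

theorem eLpNorm_two_sq {α F : Type*} [MeasurableSpace α] [NormedAddCommGroup F] (μ : Measure α)
    (f : α → F) : eLpNorm f 2 μ ^ 2 = ∫⁻ x, ‖f x‖ₑ ^ 2 ∂μ := by
  have := eLpNorm_nnreal_pow_eq_lintegral (f := f) (μ := μ) (p := 2) two_ne_zero
  simpa using this

/-- The factor `C + 1` avoids a square root: `C ≤ (C + 1) ^ 2`. -/
theorem le_mul_add_of_sq_le {x y z C : ℝ≥0∞} (h : x ^ 2 ≤ C * (y ^ 2 + z ^ 2)) :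
    x ≤ (C + 1) * (y + z) := by
  refine (ENNReal.pow_le_pow_left_iff two_ne_zero).1 (h.trans ?_)
  calc C * (y ^ 2 + z ^ 2) ≤ (C ^ 2 + 2 * C + 1) * (y ^ 2 + z ^ 2 + 2 * y * z) := by
        refine mul_le_mul' ?_ le_self_add
        calc C ≤ 2 * C := le_mul_of_one_le_left' one_le_two
          _ ≤ C ^ 2 + 2 * C := le_add_self
          _ ≤ _ := le_self_add
    _ = _ := by ring

theorem eLpNorm_le_eLpNorm_sub_add {α F : Type*} [MeasurableSpace α] [NormedAddCommGroup F]
    {μ : Measure α} {p : α → F} (mp : AEStronglyMeasurable p μ) (P : Lp F 2 μ) :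
    eLpNorm p 2 μ ≤ eLpNorm (fun x => p x - P x) 2 μ + ‖P‖ₑ := by
  rw [Lp.enorm_def]
  have h := eLpNorm_add_le (p := 2) (mp.sub (Lp.aestronglyMeasurable P))
    (Lp.aestronglyMeasurable P) (by norm_num)
  rwa [sub_add_cancel] at h

theorem enorm_le_eLpNorm_sub_add {α F : Type*} [MeasurableSpace α] [NormedAddCommGroup F]
    {μ : Measure α} {p : α → F} (mp : AEStronglyMeasurable p μ) (P : Lp F 2 μ) :
    ‖P‖ₑ ≤ eLpNorm (fun x => p x - P x) 2 μ + eLpNorm p 2 μ := by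
  rw [Lp.enorm_def]
  have h := eLpNorm_sub_le (p := 2) mp (mp.sub (Lp.aestronglyMeasurable P)) (by norm_num)
  rw [sub_sub_cancel, add_comm] at h
  exact h

/-- Passage to the limit in an inequality between `L²`-norms. -/
theorem eLpNorm_le_of_tendsto {α₁ α₂ α₃ F₁ F₂ F₃ : Type*} [MeasurableSpace α₁]
    [MeasurableSpace α₂] [MeasurableSpace α₃] [NormedAddCommGroup F₁] [NormedAddCommGroup F₂]
    [NormedAddCommGroup F₃] {μ₁ : Measure α₁} {μ₂ : Measure α₂} {μ₃ : Measure α₃}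
    {p : ℕ → α₁ → F₁} {q : ℕ → α₂ → F₂} {r : ℕ → α₃ → F₃}
    {P : Lp F₁ 2 μ₁} {Q : Lp F₂ 2 μ₂} {R : Lp F₃ 2 μ₃} {C : ℝ≥0∞} (hC : C ≠ ⊤)
    (mp : ∀ n, AEStronglyMeasurable (p n) μ₁) (mq : ∀ n, AEStronglyMeasurable (q n) μ₂)
    (mr : ∀ n, AEStronglyMeasurable (r n) μ₃)
    (hp : Tendsto (fun n => eLpNorm (fun x => p n x - P x) 2 μ₁) atTop (𝓝 0))
    (hq : Tendsto (fun n => eLpNorm (fun x => q n x - Q x) 2 μ₂) atTop (𝓝 0))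
    (hr : Tendsto (fun n => eLpNorm (fun x => r n x - R x) 2 μ₃) atTop (𝓝 0))
    (h : ∀ n, eLpNorm (p n) 2 μ₁ ≤ C * (eLpNorm (q n) 2 μ₂ + eLpNorm (r n) 2 μ₃)) :
    ‖P‖ₑ ≤ C * (‖Q‖ₑ + ‖R‖ₑ) := by
  have lim : Tendsto (fun n => eLpNorm (fun x => p n x - P x) 2 μ₁ +
      C * ((eLpNorm (fun x => q n x - Q x) 2 μ₂ + ‖Q‖ₑ)
        + (eLpNorm (fun x => r n x - R x) 2 μ₃ + ‖R‖ₑ))) atTop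
      (𝓝 (0 + C * ((0 + ‖Q‖ₑ) + (0 + ‖R‖ₑ)))) :=
    hp.add (ENNReal.Tendsto.const_mul ((hq.add tendsto_const_nhds).add
      (hr.add tendsto_const_nhds)) (Or.inr hC))
  simp only [zero_add] at lim
  refine ge_of_tendsto' lim fun n => ?_
  exact (enorm_le_eLpNorm_sub_add (mp n) P).trans (add_le_add le_rfl ((h n).trans
    (mul_le_mul_right (add_le_add (eLpNorm_le_eLpNorm_sub_add (mq n) Q)
      (eLpNorm_le_eLpNorm_sub_add (mr n) R)) C)))

theorem norm_le_of_enorm_le {E F : Type*} [SeminormedAddGroup E] [SeminormedAddGroup F] {x : E}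
    {y : F} {C : ℝ≥0∞} (hC : C ≠ ⊤) (h : ‖x‖ₑ ≤ C * ‖y‖ₑ) : ‖x‖ ≤ C.toReal * ‖y‖ := by
  have := ENNReal.toReal_mono (ENNReal.mul_ne_top hC enorm_ne_top) h
  rwa [ENNReal.toReal_mul, toReal_enorm, toReal_enorm] at this

section H1

variable {Ω S : Set (EuclideanSpace ℝ (Fin d))}

theorem norm_sq_eq (u : H1 Ω) : ‖u‖ ^ 2 = ‖toL2 u‖ ^ 2 + ‖weakGrad u‖ ^ 2 :=
  WithLp.prod_norm_sq_eq_of_L2 _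

theorem norm_toL2_le (u : H1 Ω) : ‖toL2 u‖ ≤ ‖u‖ :=
  le_of_sq_le_sq (by rw [norm_sq_eq u]; nlinarith [sq_nonneg ‖weakGrad u‖]) (norm_nonneg u)

theorem norm_weakGrad_le (u : H1 Ω) : ‖weakGrad u‖ ≤ ‖u‖ :=
  le_of_sq_le_sq (by rw [norm_sq_eq u]; nlinarith [sq_nonneg ‖toL2 u‖]) (norm_nonneg u)

/-- For each test function the defining identity equates two `L²` pairings continuous in the pair,
so `H1` is an intersection of closed sets. Completeness follows. -/
theorem isClosed_H1 (Ω : Set (EuclideanSpace ℝ (Fin d))) :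
    IsClosed (H1 Ω : Set (WithLp 2 (Lp ℝ 2
      ((volume : Measure (EuclideanSpace ℝ (Fin d))).restrict Ω) ×
      Lp (EuclideanSpace ℝ (Fin d)) 2 (volume.restrict Ω)))) := by
  let B : ℝ →L[ℝ] EuclideanSpace ℝ (Fin d) →L[ℝ] EuclideanSpace ℝ (Fin d) :=
    ContinuousLinearMap.lsmul ℝ ℝ
  have hset : (H1 Ω : Set (WithLp 2 (Lp ℝ 2
      ((volume : Measure (EuclideanSpace ℝ (Fin d))).restrict Ω) ×
      Lp (EuclideanSpace ℝ (Fin d)) 2 (volume.restrict Ω)))) =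
      ⋂ (φ : EuclideanSpace ℝ (Fin d) → ℝ) (_ : ContDiff ℝ ∞ φ) (_ : HasCompactSupport φ)
        (_ : tsupport φ ⊆ Ω), {w | ∫ x in Ω, w.fst x • ∇ φ x = - ∫ x in Ω, φ x • w.snd x} := by
    ext w
    simp only [Set.mem_iInter]
    rfl
  rw [hset]
  refine isClosed_iInter fun φ => isClosed_iInter fun h1 => isClosed_iInter fun h2 =>
    isClosed_iInter fun _ => ?_
  have m1 : MemLp φ 2 (volume.restrict Ω) :=
    (h1.continuous.memLp_of_hasCompactSupport h2 : MemLp φ 2 volume).restrict Ω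
  have m2 : MemLp (fun x => ∇ φ x) 2 (volume.restrict Ω) :=
    ((continuous_gradient_of_contDiff h1).memLp_of_hasCompactSupport
      (hasCompactSupport_gradient h2) : MemLp _ 2 volume).restrict Ω
  have e1 : ∀ w : WithLp 2 (Lp ℝ 2 ((volume : Measure (EuclideanSpace ℝ (Fin d))).restrict Ω) ×
      Lp (EuclideanSpace ℝ (Fin d)) 2 (volume.restrict Ω)),
      ∫ x in Ω, w.fst x • ∇ φ x = B.lpPairing (volume.restrict Ω) 2 2 w.fst m2.toLp := fun w => by
    rw [ContinuousLinearMap.lpPairing_eq_integral]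
    refine integral_congr_ae ?_
    filter_upwards [m2.coeFn_toLp] with x hx
    rw [hx]; rfl
  have e2 : ∀ w : WithLp 2 (Lp ℝ 2 ((volume : Measure (EuclideanSpace ℝ (Fin d))).restrict Ω) ×
      Lp (EuclideanSpace ℝ (Fin d)) 2 (volume.restrict Ω)),
      ∫ x in Ω, φ x • w.snd x = B.lpPairing (volume.restrict Ω) 2 2 m1.toLp w.snd := fun w => by
    rw [ContinuousLinearMap.lpPairing_eq_integral]
    refine integral_congr_ae ?_
    filter_upwards [m1.coeFn_toLp] with x hx
    rw [hx]; rfl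
  simp only [e1, e2]
  refine isClosed_eq ?_ ?_
  · exact ((B.lpPairing (volume.restrict Ω) 2 2).flip m2.toLp).continuous.comp
      (WithLp.fstL 2 ℝ _ _).continuous
  · exact ((B.lpPairing (volume.restrict Ω) 2 2 m1.toLp).continuous.comp
      (WithLp.sndL 2 ℝ _ _).continuous).neg

instance : CompleteSpace (H1 Ω) := (isClosed_H1 Ω).completeSpace_coe

theorem hasTrace_of_forall {u : H1 Ω} {t : Lp ℝ 2 (surfaceMeasure S)}
    (h : ∀ ε : ℝ≥0∞, 0 < ε → ∃ φ : EuclideanSpace ℝ (Fin d) → ℝ,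
      (ContDiff ℝ ∞ φ ∧ HasCompactSupport φ) ∧
      eLpNorm (fun x => φ x - toL2 u x) 2 (volume.restrict Ω) ≤ ε ∧
      eLpNorm (fun x => ∇ φ x - weakGrad u x) 2 (volume.restrict Ω) ≤ ε ∧
      eLpNorm (fun x => φ x - t x) 2 (surfaceMeasure S) ≤ ε) : HasTrace S u t := by
  have hpos : ∀ n : ℕ, 0 < ((n : ℝ≥0∞) + 1)⁻¹ := fun n =>
    ENNReal.inv_pos.2 (by finiteness)
  choose φ hφ h1 h2 h3 using fun n : ℕ => h _ (hpos n)
  have lim : Tendsto (fun n : ℕ => ((n : ℝ≥0∞) + 1)⁻¹) atTop (𝓝 0) := by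
    have := (tendsto_add_atTop_iff_nat 1).2 ENNReal.tendsto_inv_nat_nhds_zero
    simpa using this
  exact ⟨φ, hφ, tendsto_of_tendsto_of_tendsto_of_le_of_le tendsto_const_nhds lim
      (fun _ => zero_le) h1,
    tendsto_of_tendsto_of_tendsto_of_le_of_le tendsto_const_nhds lim (fun _ => zero_le) h2,
    tendsto_of_tendsto_of_tendsto_of_le_of_le tendsto_const_nhds lim (fun _ => zero_le) h3⟩

/-- The functions with vanishing trace form a closed subspace of `H¹(Ω)`. -/
theorem isClosed_H1Diamond (Ω S : Set (EuclideanSpace ℝ (Fin d))) :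
    IsClosed (H1Diamond Ω S : Set (H1 Ω)) := by
  refine isClosed_of_closure_subset fun u hu => hasTrace_of_forall fun ε hε => ?_
  have hε2 : 0 < ε / 2 := ENNReal.half_pos hε.ne'
  -- Diagonal argument: a smooth approximant of a nearby `v` also approximates `u`. The boundary
  -- estimate needs no triangle inequality, since the target trace is `0` for both.
  obtain ⟨v, hv, huv⟩ := EMetric.mem_closure_iff.1 hu (ε / 2) hε2
  obtain ⟨φ, hφ, h1, h2, h3⟩ : HasTrace S v 0 := hv
  obtain ⟨n, n1, n2, n3⟩ := ((h1.eventually (gt_mem_nhds hε2)).and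
    ((h2.eventually (gt_mem_nhds hε2)).and (h3.eventually (gt_mem_nhds hε2)))).exists
  have tri : ∀ {F : Type} [NormedAddCommGroup F]
      (p : EuclideanSpace ℝ (Fin d) → F) (P Q : Lp F 2 (volume.restrict Ω)),
      AEStronglyMeasurable p (volume.restrict Ω) →
      eLpNorm (fun x => p x - P x) 2 (volume.restrict Ω) < ε / 2 → edist P Q ≤ ε / 2 →
      eLpNorm (fun x => p x - Q x) 2 (volume.restrict Ω) ≤ ε := by
    intro F _ p P Q mp hp hPQ
    rw [Lp.edist_def] at hPQ
    have h := eLpNorm_add_le (p := 2) (mp.sub (Lp.aestronglyMeasurable P))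
      ((Lp.aestronglyMeasurable P).sub (Lp.aestronglyMeasurable Q)) (by norm_num)
    rw [sub_add_sub_cancel] at h
    exact h.trans ((add_le_add hp.le hPQ).trans_eq (ENNReal.add_halves ε))
  have d1 : edist (toL2 v) (toL2 u) ≤ ε / 2 := by
    refine le_trans ?_ huv.le
    rw [edist_comm u v, edist_dist, edist_dist, dist_eq_norm, dist_eq_norm]
    exact ENNReal.ofReal_le_ofReal (norm_toL2_le (v - u))
  have d2 : edist (weakGrad v) (weakGrad u) ≤ ε / 2 := by
    refine le_trans ?_ huv.le
    rw [edist_comm u v, edist_dist, edist_dist, dist_eq_norm, dist_eq_norm]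
    exact ENNReal.ofReal_le_ofReal (norm_weakGrad_le (v - u))
  refine ⟨φ n, hφ n, tri _ _ _ (hφ n).1.continuous.aestronglyMeasurable n1 d1,
    tri _ _ _ (continuous_gradient_of_contDiff (hφ n).1).aestronglyMeasurable n2 d2,
    n3.le.trans ENNReal.half_le_self⟩

theorem H1Diamond.hasTrace (u : H1Diamond Ω S) : HasTrace S (u : H1 Ω) 0 := u.2

/-- The boundary term of the Poincaré inequality disappears in the limit because the trace on `S` is
zero. -/
theorem exists_norm_le_weakGrad (hP : IsControlled Ω S Ω) :
    ∃ C : ℝ, 0 ≤ C ∧ ∀ u : H1Diamond Ω S, ‖toL2 (u : H1 Ω)‖ ≤ C * ‖weakGrad (u : H1 Ω)‖ := by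
  obtain ⟨C, hC, h⟩ := hP
  refine ⟨(C + 1).toReal, ENNReal.toReal_nonneg, fun u => ?_⟩
  obtain ⟨φ, hφ, h1, h2, h3⟩ := H1Diamond.hasTrace u
  have key := eLpNorm_le_of_tendsto (C := C + 1) (by finiteness)
    (fun n => (hφ n).1.continuous.aestronglyMeasurable)
    (fun n => (hφ n).1.continuous.aestronglyMeasurable)
    (fun n => (continuous_gradient_of_contDiff (hφ n).1).aestronglyMeasurable) h1 h3 h2
    (fun n => le_mul_add_of_sq_le (by
      rw [eLpNorm_two_sq, eLpNorm_two_sq, eLpNorm_two_sq]; exact h _ (hφ n).1))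
  rw [enorm_zero, zero_add] at key
  exact norm_le_of_enorm_le (by finiteness) key

/-- The trace inequality `‖φ‖_{L²(S)} ≤ C ‖φ‖_{H¹(Ω)}` for smooth functions. -/
def HasTraceInequality (Ω S : Set (EuclideanSpace ℝ (Fin d))) : Prop :=
  ∃ C : ℝ≥0∞, C ≠ ⊤ ∧ ∀ φ : EuclideanSpace ℝ (Fin d) → ℝ, ContDiff ℝ ∞ φ →
    eLpNorm φ 2 (surfaceMeasure S) ≤ C * (eLpNorm φ 2 (volume.restrict Ω)
      + eLpNorm (fun x => ∇ φ x) 2 (volume.restrict Ω))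

theorem HasTraceInequality.exists_norm_le (h : HasTraceInequality Ω S) :
    ∃ C : ℝ, 0 ≤ C ∧ ∀ (u : H1 Ω) (t : Lp ℝ 2 (surfaceMeasure S)), HasTrace S u t →
      ‖t‖ ≤ C * ‖u‖ := by
  obtain ⟨C, hC, h⟩ := h
  refine ⟨C.toReal * 2, by positivity, fun u t => ?_⟩
  rintro ⟨φ, hφ, h1, h2, h3⟩
  have key := eLpNorm_le_of_tendsto hC
    (fun n => (hφ n).1.continuous.aestronglyMeasurable)
    (fun n => (hφ n).1.continuous.aestronglyMeasurable)
    (fun n => (continuous_gradient_of_contDiff (hφ n).1).aestronglyMeasurable) h3 h1 h2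
    (fun n => h _ (hφ n).1)
  have := ENNReal.toReal_mono (ENNReal.mul_ne_top hC (ENNReal.add_ne_top.2
    ⟨enorm_ne_top, enorm_ne_top⟩)) key
  rw [ENNReal.toReal_mul, ENNReal.toReal_add enorm_ne_top enorm_ne_top, toReal_enorm,
    toReal_enorm, toReal_enorm] at this
  refine this.trans ?_
  rw [mul_assoc]
  gcongr
  linarith [norm_toL2_le u, norm_weakGrad_le u]

/-- The difference `s - t` is a trace of the zero function, so the trace inequality forces it to
vanish. -/
theorem HasTrace.unique (h : HasTraceInequality Ω S) {u : H1 Ω}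
    {s t : Lp ℝ 2 (surfaceMeasure S)} (hs : HasTrace S u s) (ht : HasTrace S u t) : s = t := by
  obtain ⟨C, -, hC⟩ := h.exists_norm_le
  have h0 := hC _ _ (hs.add (ht.smul (-1)))
  have hu : u + (-1 : ℝ) • u = 0 := by module
  rw [hu, norm_zero, mul_zero] at h0
  have h1 := norm_le_zero_iff.1 h0
  rw [neg_one_smul, ← sub_eq_add_neg] at h1
  exact sub_eq_zero.1 h1

/-- Limits in `H¹(Ω)` of smooth functions have traces. -/
theorem HasTraceInequality.exists_hasTrace (h : HasTraceInequality Ω S) {u : H1 Ω}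
    {φ : ℕ → EuclideanSpace ℝ (Fin d) → ℝ}
    (hφ : ∀ n, ContDiff ℝ ∞ (φ n) ∧ HasCompactSupport (φ n))
    (h1 : Tendsto (fun n => eLpNorm (fun x => φ n x - toL2 u x) 2 (volume.restrict Ω)) atTop (𝓝 0))
    (h2 : Tendsto (fun n => eLpNorm (fun x => ∇ (φ n) x - weakGrad u x) 2 (volume.restrict Ω))
      atTop (𝓝 0)) : ∃ t, HasTrace S u t := by
  obtain ⟨C, hC, h⟩ := h
  have mf : ∀ n, AEStronglyMeasurable (φ n) (volume.restrict Ω) :=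
    fun n => (hφ n).1.continuous.aestronglyMeasurable
  have mg : ∀ n, AEStronglyMeasurable (fun x => ∇ (φ n) x) (volume.restrict Ω) :=
    fun n => (continuous_gradient_of_contDiff (hφ n).1).aestronglyMeasurable
  have mem : ∀ n, MemLp (φ n) 2 (surfaceMeasure S) := fun n => by
    refine ⟨(hφ n).1.continuous.aestronglyMeasurable, (h _ (hφ n).1).trans_lt ?_⟩
    have m1 : MemLp (φ n) 2 (volume.restrict Ω) :=
      ((hφ n).1.continuous.memLp_of_hasCompactSupport (hφ n).2 : MemLp _ 2 volume).restrict Ω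
    have m2 : MemLp (fun x => ∇ (φ n) x) 2 (volume.restrict Ω) :=
      ((continuous_gradient_of_contDiff (hφ n).1).memLp_of_hasCompactSupport
        (hasCompactSupport_gradient (hφ n).2) : MemLp _ 2 volume).restrict Ω
    have := m1.eLpNorm_ne_top
    have := m2.eLpNorm_ne_top
    finiteness
  have tri : ∀ {F : Type} [NormedAddCommGroup F] (p q : EuclideanSpace ℝ (Fin d) → F)
      (P : Lp F 2 (volume.restrict Ω)), AEStronglyMeasurable p (volume.restrict Ω) →
      AEStronglyMeasurable q (volume.restrict Ω) →
      eLpNorm (fun x => p x - q x) 2 (volume.restrict Ω) ≤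
        eLpNorm (fun x => p x - P x) 2 (volume.restrict Ω)
          + eLpNorm (fun x => q x - P x) 2 (volume.restrict Ω) := by
    intro F _ p q P mp mq
    have h := eLpNorm_sub_le (p := 2) (mp.sub (Lp.aestronglyMeasurable P))
      (mq.sub (Lp.aestronglyMeasurable P)) (by norm_num)
    rw [sub_sub_sub_cancel_right] at h
    exact h
  -- `δ n` is `C` times the `H¹` error of `φ n`. The trace inequality for `φ n - φ k` makes the
  -- boundary values Cauchy in `L²(S)`.
  set δ : ℕ → ℝ≥0∞ := fun n => C * (eLpNorm (fun x => φ n x - toL2 u x) 2 (volume.restrict Ω)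
    + eLpNorm (fun x => ∇ (φ n) x - weakGrad u x) 2 (volume.restrict Ω)) with hδ
  have hδ0 : Tendsto δ atTop (𝓝 0) := by
    have := ENNReal.Tendsto.const_mul (h1.add h2) (Or.inr hC)
    simpa using this
  have hdist : ∀ n k, edist ((mem n).toLp) ((mem k).toLp) ≤ δ n + δ k := by
    intro n k
    rw [Lp.edist_toLp_toLp]
    refine (h _ ((hφ n).1.sub (hφ k).1)).trans ?_
    rw [hδ, ← mul_add]
    refine mul_le_mul_right ?_ C
    have t1 := tri (φ n) (φ k) (toL2 u) (mf n) (mf k)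
    have t2 := tri _ _ (weakGrad u) (mg n) (mg k)
    have e : (fun x => ∇ (fun x => φ n x - φ k x) x) = fun x => ∇ (φ n) x - ∇ (φ k) x := by
      funext x
      unfold gradient
      rw [fderiv_fun_sub ((hφ n).1.differentiable (by simp) x)
        ((hφ k).1.differentiable (by simp) x), map_sub]
    rw [e]
    refine (add_le_add t1 t2).trans_eq ?_
    ring
  have hcau : CauchySeq fun n => (mem n).toLp := by
    rw [EMetric.cauchySeq_iff']
    intro ε hε
    obtain ⟨N, hN⟩ := eventually_atTop.1
      (hδ0.eventually (gt_mem_nhds (ENNReal.half_pos hε.ne')))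
    refine ⟨N, fun n hn => (hdist n N).trans_lt ?_⟩
    calc δ n + δ N < ε / 2 + ε / 2 := ENNReal.add_lt_add (hN n hn) (hN N le_rfl)
      _ = ε := ENNReal.add_halves ε
  obtain ⟨t, ht⟩ := cauchySeq_tendsto_of_complete hcau
  refine ⟨t, φ, hφ, h1, h2, ?_⟩
  rw [Lp.tendsto_Lp_iff_tendsto_eLpNorm'] at ht
  refine ht.congr fun n => eLpNorm_congr_ae ?_
  filter_upwards [(mem n).coeFn_toLp] with x hx
  rw [Pi.sub_apply, hx]

/-- The space `H1Diamond Ω Γ₀` as a Hilbert space in its own right. -/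
def Diamond (Ω Γ₀ : Set (EuclideanSpace ℝ (Fin d))) : Type := ↥(H1Diamond Ω Γ₀)

namespace Diamond

variable {Γ Γ₀ : Set (EuclideanSpace ℝ (Fin d))}

instance : NormedAddCommGroup (Diamond Ω Γ₀) :=
  inferInstanceAs (NormedAddCommGroup ↥(H1Diamond Ω Γ₀))

instance : InnerProductSpace ℝ (Diamond Ω Γ₀) :=
  inferInstanceAs (InnerProductSpace ℝ ↥(H1Diamond Ω Γ₀))

instance : CompleteSpace (Diamond Ω Γ₀) := (isClosed_H1Diamond Ω Γ₀).completeSpace_coe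

/-- The inclusion into `H¹(Ω)`. -/
def toH1 (u : Diamond Ω Γ₀) : H1 Ω := Subtype.val u

/-- The smooth sequence witnessing the zero trace on `Γ₀` also yields a trace on `Γ`, so no density
theorem for `H¹(Ω)` is needed. -/
theorem exists_hasTrace (h : HasTraceInequality Ω Γ) (u : Diamond Ω Γ₀) :
    ∃ t, HasTrace Γ u.toH1 t := by
  obtain ⟨φ, hφ, h1, h2, -⟩ := H1Diamond.hasTrace u
  exact h.exists_hasTrace hφ h1 h2

/-- The trace on `Γ` of functions vanishing on `Γ₀`, as a linear map. -/
def traceLinear (h : HasTraceInequality Ω Γ) (Γ₀ : Set (EuclideanSpace ℝ (Fin d))) :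
    Diamond Ω Γ₀ →ₗ[ℝ] Lp ℝ 2 (surfaceMeasure Γ) where
  toFun u := (exists_hasTrace h u).choose
  -- Uniqueness of traces makes the chosen values linear.
  map_add' u v := (exists_hasTrace h (u + v)).choose_spec.unique h
    ((exists_hasTrace h u).choose_spec.add (exists_hasTrace h v).choose_spec)
  map_smul' c u := (exists_hasTrace h (c • u)).choose_spec.unique h
    ((exists_hasTrace h u).choose_spec.smul c)

theorem hasTrace_traceLinear (h : HasTraceInequality Ω Γ) (u : Diamond Ω Γ₀) :
    HasTrace Γ u.toH1 (traceLinear h Γ₀ u) :=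
  (exists_hasTrace h u).choose_spec

theorem norm_traceLinear_le (h : HasTraceInequality Ω Γ) (u : Diamond Ω Γ₀) :
    ‖traceLinear h Γ₀ u‖ ≤ h.exists_norm_le.choose * ‖u‖ :=
  h.exists_norm_le.choose_spec.2 _ _ (hasTrace_traceLinear h u)

/-- The trace operator on `Γ` for functions vanishing on `Γ₀`. -/
def traceOperator (h : HasTraceInequality Ω Γ) (Γ₀ : Set (EuclideanSpace ℝ (Fin d))) :
    Diamond Ω Γ₀ →L[ℝ] Lp ℝ 2 (surfaceMeasure Γ) :=
  (traceLinear h Γ₀).mkContinuous _ (norm_traceLinear_le h)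

theorem hasTrace_traceOperator (h : HasTraceInequality Ω Γ) (u : Diamond Ω Γ₀) :
    HasTrace Γ u.toH1 (traceOperator h Γ₀ u) :=
  hasTrace_traceLinear h u

/-- The weak gradient as a linear map. -/
def gradLinear (Ω Γ₀ : Set (EuclideanSpace ℝ (Fin d))) :
    Diamond Ω Γ₀ →ₗ[ℝ] Lp (EuclideanSpace ℝ (Fin d)) 2
      ((volume : Measure (EuclideanSpace ℝ (Fin d))).restrict Ω) where
  toFun u := weakGrad u.toH1
  map_add' _ _ := rfl
  map_smul' _ _ := rfl

theorem norm_gradLinear_le (u : Diamond Ω Γ₀) : ‖gradLinear Ω Γ₀ u‖ ≤ 1 * ‖u‖ := by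
  rw [one_mul]
  exact norm_weakGrad_le u.toH1

/-- The weak gradient on `H¹_◇(Ω)`. -/
def grad (Ω Γ₀ : Set (EuclideanSpace ℝ (Fin d))) :
    Diamond Ω Γ₀ →L[ℝ] Lp (EuclideanSpace ℝ (Fin d)) 2
      ((volume : Measure (EuclideanSpace ℝ (Fin d))).restrict Ω) :=
  (gradLinear Ω Γ₀).mkContinuous 1 norm_gradLinear_le

theorem grad_apply (u : Diamond Ω Γ₀) : grad Ω Γ₀ u = weakGrad u.toH1 := rfl

theorem norm_sq_eq (u : Diamond Ω Γ₀) :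
    ‖u‖ ^ 2 = ‖RobinProblem.toL2 u.toH1‖ ^ 2 + ‖weakGrad u.toH1‖ ^ 2 :=
  RobinProblem.norm_sq_eq u.toH1

theorem exists_coercive (hP : IsControlled Ω Γ₀ Ω) :
    ∃ α : ℝ, 0 < α ∧ ∀ u : Diamond Ω Γ₀, α * ‖u‖ ^ 2 ≤ ‖grad Ω Γ₀ u‖ ^ 2 := by
  -- With the Poincaré constant `C`, `‖u‖² ≤ (C² + 1) ‖∇u‖²`.
  obtain ⟨C, hC, h⟩ := exists_norm_le_weakGrad hP
  refine ⟨(C ^ 2 + 1)⁻¹, by positivity, fun u => ?_⟩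
  have h1 : ‖RobinProblem.toL2 u.toH1‖ ≤ C * ‖weakGrad u.toH1‖ := h u
  rw [grad_apply, inv_mul_le_iff₀ (by positivity), norm_sq_eq]
  nlinarith [pow_le_pow_left₀ (norm_nonneg _) h1 2]

end Diamond

end H1

end

/-! ### The abstract monotone problem -/

section Abstract

variable {V H X : Type*} [NormedAddCommGroup V] [InnerProductSpace ℝ V] [CompleteSpace V]
  [NormedAddCommGroup H] [InnerProductSpace ℝ H] [CompleteSpace H] [MeasurableSpace X]
  {μ : Measure X} {β : ℝ → ℝ} {K : ℝ≥0} {a : X → ℝ}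

/-- The superposition operator `t ↦ a β(t)` on `L²`. -/
def superposition (hβ : LipschitzWith K β) (β0 : β 0 = 0) (ha : MemLp a ⊤ μ) (t : Lp ℝ 2 μ) :
    Lp ℝ 2 μ := (ha.toLp : Lp ℝ ⊤ μ) • hβ.compLp β0 t

theorem coeFn_superposition (hβ : LipschitzWith K β) (β0 : β 0 = 0) (ha : MemLp a ⊤ μ)
    (t : Lp ℝ 2 μ) : superposition hβ β0 ha t =ᵐ[μ] fun x => a x * β (t x) := by
  filter_upwards [Lp.coeFn_lpSMul (r := 2) (ha.toLp : Lp ℝ ⊤ μ) (hβ.compLp β0 t),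
    ha.coeFn_toLp, hβ.coeFn_compLp β0 t] with x h1 h2 h3
  rw [superposition, h1, Pi.smul_apply', h2, h3, smul_eq_mul, Function.comp_apply]

theorem inner_superposition (hβ : LipschitzWith K β) (β0 : β 0 = 0) (ha : MemLp a ⊤ μ)
    (t s : Lp ℝ 2 μ) : inner ℝ (superposition hβ β0 ha t) s = ∫ x, a x * β (t x) * s x ∂μ := by
  rw [L2.inner_def]
  refine integral_congr_ae ?_
  filter_upwards [coeFn_superposition hβ β0 ha t] with x hx
  rw [hx, real_inner_eq_re_inner]
  simp [mul_comm]

theorem norm_superposition_sub_le (hβ : LipschitzWith K β) (β0 : β 0 = 0) (ha : MemLp a ⊤ μ)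
    (s t : Lp ℝ 2 μ) : ‖superposition hβ β0 ha s - superposition hβ β0 ha t‖
      ≤ ‖(ha.toLp : Lp ℝ ⊤ μ)‖ * (K * ‖s - t‖) := by
  have e : superposition hβ β0 ha s - superposition hβ β0 ha t =
      (ha.toLp : Lp ℝ ⊤ μ) • (hβ.compLp β0 s - hβ.compLp β0 t) := by
    rw [superposition, superposition, sub_eq_add_neg, sub_eq_add_neg, Lp.add_smul, Lp.smul_neg]
  rw [e]
  refine (Lp.norm_smul_le _ _).trans ?_
  gcongr
  exact hβ.norm_compLp_sub_le β0 s t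

/-- Pointwise, `s - t` and `β(s) - β(t)` have the same sign, and the weight `a` is non-negative. -/
theorem inner_superposition_sub_nonneg (hβ : LipschitzWith K β) (β0 : β 0 = 0)
    (hmono : Monotone β) (ha : MemLp a ⊤ μ) (ha0 : ∀ᵐ x ∂μ, 0 ≤ a x) (s t : Lp ℝ 2 μ) :
    0 ≤ inner ℝ (superposition hβ β0 ha s - superposition hβ β0 ha t) (s - t) := by
  rw [L2.inner_def]
  refine integral_nonneg_of_ae ?_
  filter_upwards [coeFn_superposition hβ β0 ha s, coeFn_superposition hβ β0 ha t,
    Lp.coeFn_sub (superposition hβ β0 ha s) (superposition hβ β0 ha t), Lp.coeFn_sub s t, ha0]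
    with x h1 h2 h3 h4 h5
  rw [h3, h4, Pi.sub_apply, Pi.sub_apply, h1, h2]
  change 0 ≤ (s x - t x) * (a x * β (s x) - a x * β (t x))
  have key : 0 ≤ (s x - t x) * (β (s x) - β (t x)) := by
    rcases le_total (s x) (t x) with h | h
    · exact mul_nonneg_of_nonpos_of_nonpos (sub_nonpos.2 h) (sub_nonpos.2 (hmono h))
    · exact mul_nonneg (sub_nonneg.2 h) (sub_nonneg.2 (hmono h))
  have := mul_nonneg h5 key
  linarith

/-- Existence, uniqueness and a priori bound for a coercive quadratic form perturbed by a
monotone superposition operator. -/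
theorem existsUnique_of_coercive (G : V →L[ℝ] H) (T : V →L[ℝ] Lp ℝ 2 μ) {α : ℝ} (hα : 0 < α)
    (hcoer : ∀ u, α * ‖u‖ ^ 2 ≤ ‖G u‖ ^ 2) (hβ : LipschitzWith K β) (β0 : β 0 = 0)
    (hmono : Monotone β) (ha : MemLp a ⊤ μ) (ha0 : ∀ᵐ x ∂μ, 0 ≤ a x) (l : V →ₗ[ℝ] ℝ)
    {c : ℝ} (hc : 0 ≤ c) (hl : ∀ v, ‖l v‖ ≤ c * ‖v‖) :
    (∃! u, ∀ v, inner ℝ (G u) (G v) + ∫ x, a x * β (T u x) * T v x ∂μ = l v) ∧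
    ∀ u, (∀ v, inner ℝ (G u) (G v) + ∫ x, a x * β (T u x) * T v x ∂μ = l v) →
      ‖u‖ ≤ α⁻¹ * c := by
  set N := superposition hβ β0 ha with hN
  -- Adjoints move the weak form into `V`: `⟪F u, v⟫` is its left-hand side.
  set F : V → V := fun u => G.adjoint (G u) + T.adjoint (N (T u)) with hF
  have hFinner : ∀ u v, inner ℝ (F u) v =
      inner ℝ (G u) (G v) + ∫ x, a x * β (T u x) * T v x ∂μ := fun u v => by
    rw [hF, inner_add_left, ContinuousLinearMap.adjoint_inner_left,
      ContinuousLinearMap.adjoint_inner_left, hN, inner_superposition]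
  have hsub : ∀ u v, F u - F v = G.adjoint (G (u - v)) + T.adjoint (N (T u) - N (T v)) :=
    fun u v => by
      simp only [hF, map_sub]
      abel
  have hFmono : ∀ u v, α * ‖u - v‖ ^ 2 ≤ inner ℝ (F u - F v) (u - v) := fun u v => by
    rw [hsub, inner_add_left, ContinuousLinearMap.adjoint_inner_left,
      ContinuousLinearMap.adjoint_inner_left, real_inner_self_eq_norm_sq, map_sub T]
    have := inner_superposition_sub_nonneg hβ β0 hmono ha ha0 (T u) (T v)
    linarith [hcoer (u - v)]
  have hFlip : ∀ u v, ‖F u - F v‖ ≤ (‖G.adjoint‖ * ‖G‖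
      + ‖T.adjoint‖ * (‖(ha.toLp : Lp ℝ ⊤ μ)‖ * (K * ‖T‖))) * ‖u - v‖ := fun u v => by
    rw [hsub, add_mul]
    refine (norm_add_le _ _).trans (add_le_add ?_ ?_)
    · rw [mul_assoc]
      exact (G.adjoint.le_opNorm _).trans (by gcongr; exact G.le_opNorm _)
    · refine (T.adjoint.le_opNorm _).trans ?_
      rw [mul_assoc, mul_assoc, mul_assoc]
      refine mul_le_mul_of_nonneg_left ((norm_superposition_sub_le hβ β0 ha _ _).trans ?_)
        (norm_nonneg _)
      rw [← map_sub]
      gcongr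
      exact T.le_opNorm _
  have hbij := bijective_of_stronglyMonotone hα hFmono hFlip
  -- The Riesz representative of the load, so that the weak form becomes `F u = b`.
  set b : V := (InnerProductSpace.toDual ℝ V).symm (l.mkContinuous c hl) with hb
  have hiff : ∀ u, (∀ v, inner ℝ (G u) (G v) + ∫ x, a x * β (T u x) * T v x ∂μ = l v) ↔
      F u = b := fun u => by
    simp only [← hFinner]
    constructor
    · intro h
      refine ext_inner_right ℝ fun v => ?_
      rw [h v, hb, InnerProductSpace.toDual_symm_apply, LinearMap.mkContinuous_apply]
    · intro h v
      rw [h, hb, InnerProductSpace.toDual_symm_apply, LinearMap.mkContinuous_apply]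
  refine ⟨?_, fun u hu => ?_⟩
  · simp only [hiff]
    exact hbij.existsUnique b
  -- Strong monotonicity against `0` gives the bound with `α` alone, because `F 0 = 0`.
  · have h1 := hFmono u 0
    have hF0 : F 0 = 0 := by
      have hN0 : N (T 0) = 0 := by
        rw [map_zero, hN, superposition, hβ.compLp_zero β0, Lp.smul_zero]
      change G.adjoint (G 0) + T.adjoint (N (T 0)) = 0
      rw [hN0, map_zero, map_zero, map_zero, add_zero]
    rw [hF0, sub_zero, sub_zero, hFinner, hu u] at h1
    have h2 : l u ≤ c * ‖u‖ := (le_abs_self _).trans (hl u)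
    rcases (norm_nonneg u).eq_or_lt with h0 | h0
    · rw [← h0]
      exact mul_nonneg (inv_nonneg.2 hα.le) hc
    · have h3 : α * ‖u‖ ≤ c := by
        refine le_of_mul_le_mul_right ?_ h0
        linarith [h1.trans h2, show α * ‖u‖ ^ 2 = α * ‖u‖ * ‖u‖ by ring]
      rwa [inv_mul_eq_div, le_div_iff₀ hα, mul_comm]

end Abstract

/-! ### The weak Robin problem -/

theorem exists_lipschitzWith_of_iteratedDeriv_bounded {β : ℝ → ℝ} (hβ : ContDiff ℝ 3 β)
    (h : ∃ M : ℝ, ∀ r : ℝ, |iteratedDeriv 1 β r| ≤ M) : ∃ K, LipschitzWith K β := by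
  obtain ⟨M, hM⟩ := h
  refine ⟨M.toNNReal, lipschitzWith_of_nnnorm_deriv_le (hβ.differentiable (by norm_num))
    fun x => ?_⟩
  have := hM x
  rw [iteratedDeriv_one] at this
  exact NNReal.le_toNNReal_of_coe_le this

namespace Diamond

variable {d : ℕ} {Ω Γ Γ₀ : Set (EuclideanSpace ℝ (Fin d))}

/-- The trace operator with values in `H^{1/2}(Γ)`. -/
def traceHalf (h : HasTraceInequality Ω Γ) (Γ₀ : Set (EuclideanSpace ℝ (Fin d))) :
    Diamond Ω Γ₀ →ₗ[ℝ] HHalf Ω Γ :=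
  LinearMap.codRestrict (traces Ω Γ) (traceLinear h Γ₀)
    fun u => ⟨u.toH1, hasTrace_traceLinear h u⟩

theorem eq_traceHalf (h : HasTraceInequality Ω Γ) {u : Diamond Ω Γ₀} {t : HHalf Ω Γ}
    (ht : HasTrace Γ u.toH1 t.toL2) : t = traceHalf h Γ₀ u :=
  (traces Ω Γ).injective_subtype (ht.unique h (hasTrace_traceOperator h u))

/-- The function `u` itself competes in the infimum defining the trace norm; hence `g` enters the
estimate with factor one. -/
theorem norm_traceHalf_le (h : HasTraceInequality Ω Γ) (u : Diamond Ω Γ₀) :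
    ‖traceHalf h Γ₀ u‖ ≤ ‖u‖ :=
  traceNorm_le (hasTrace_traceLinear h u)

/-- The inclusion into `H¹(Ω)` as a linear map. -/
def inclusion (Ω Γ₀ : Set (EuclideanSpace ℝ (Fin d))) : Diamond Ω Γ₀ →ₗ[ℝ] H1 Ω where
  toFun := toH1
  map_add' _ _ := rfl
  map_smul' _ _ := rfl

/-- The right-hand side of the weak formulation. -/
def load (h : HasTraceInequality Ω Γ) (Γ₀ : Set (EuclideanSpace ℝ (Fin d)))
    (f : StrongDual ℝ (H1 Ω)) (g : StrongDual ℝ (HHalf Ω Γ)) : Diamond Ω Γ₀ →ₗ[ℝ] ℝ :=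
  -(f.toLinearMap.comp (inclusion Ω Γ₀)) + g.toLinearMap.comp (traceHalf h Γ₀)

theorem norm_load_le (h : HasTraceInequality Ω Γ) (f : StrongDual ℝ (H1 Ω))
    (g : StrongDual ℝ (HHalf Ω Γ)) (u : Diamond Ω Γ₀) :
    ‖load h Γ₀ f g u‖ ≤ (‖f‖ + ‖g‖) * ‖u‖ := by
  have aux : ∀ {x y p q r : ℝ}, ‖x‖ ≤ p * r → ‖y‖ ≤ q * r → ‖-x + y‖ ≤ (p + q) * r := by
    intro x y p q r hx hy
    refine (norm_add_le _ _).trans ?_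
    rw [norm_neg, add_mul]
    exact add_le_add hx hy
  have h1 : ‖f u.toH1‖ ≤ ‖f‖ * ‖u‖ := f.le_opNorm u.toH1
  have h2 : ‖g (traceHalf h Γ₀ u)‖ ≤ ‖g‖ * ‖u‖ :=
    (g.le_opNorm _).trans (mul_le_mul_of_nonneg_left (norm_traceHalf_le h u) (norm_nonneg g))
  exact aux h1 h2

/-- Traces are unique, so the quantified traces `t` and `s` must be the values of the trace
operator; this puts the problem in the form of `existsUnique_of_coercive`. -/
theorem isWeakSolution_iff (h : HasTraceInequality Ω Γ) {β : ℝ → ℝ}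
    {a : EuclideanSpace ℝ (Fin d) → ℝ} {f : StrongDual ℝ (H1 Ω)}
    {g : StrongDual ℝ (HHalf Ω Γ)} {u : Diamond Ω Γ₀} :
    IsWeakSolution (Γ₀ := Γ₀) β a f g u ↔ ∀ v : Diamond Ω Γ₀,
      inner ℝ (grad Ω Γ₀ u) (grad Ω Γ₀ v)
        + ∫ x, a x * β (traceOperator h Γ₀ u x) * traceOperator h Γ₀ v x ∂(surfaceMeasure Γ)
        = load h Γ₀ f g v := by
  constructor
  · rintro ⟨t, ht, hu⟩ v
    have := hu v (traceHalf h Γ₀ v) (hasTrace_traceOperator h v)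
    rw [eq_traceHalf h ht] at this
    exact this
  · intro hu
    refine ⟨traceHalf h Γ₀ u, hasTrace_traceOperator h u, fun v s hs => ?_⟩
    rw [eq_traceHalf h hs]
    exact hu v

/-- Well-posedness of the weak problem from the trace inequality and coercivity. -/
theorem existsUnique_isWeakSolution (hT : HasTraceInequality Ω Γ) {α : ℝ} (hα : 0 < α)
    (hcoer : ∀ u : Diamond Ω Γ₀, α * ‖u‖ ^ 2 ≤ ‖grad Ω Γ₀ u‖ ^ 2)
    {β : ℝ → ℝ} {K : ℝ≥0} (hK : LipschitzWith K β) (β0 : β 0 = 0) (hmono : Monotone β)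
    {a : EuclideanSpace ℝ (Fin d) → ℝ} (ha : MemLp a ⊤ (surfaceMeasure Γ))
    (ha0 : ∀ᵐ x ∂(surfaceMeasure Γ), 0 ≤ a x) (f : StrongDual ℝ (H1 Ω))
    (g : StrongDual ℝ (HHalf Ω Γ)) :
    (∃! u : Diamond Ω Γ₀, IsWeakSolution (Γ₀ := Γ₀) β a f g u) ∧
      ∀ u : Diamond Ω Γ₀, IsWeakSolution (Γ₀ := Γ₀) β a f g u → ‖u‖ ≤ α⁻¹ * (‖f‖ + ‖g‖) := by
  have key := existsUnique_of_coercive (grad Ω Γ₀) (traceOperator hT Γ₀) hα hcoer hK β0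
    hmono ha ha0 (load hT Γ₀ f g)
    (add_nonneg (norm_nonneg f) (norm_nonneg g)) (norm_load_le hT f g)
  exact ⟨(existsUnique_congr fun u => isWeakSolution_iff hT).2 key.1,
    fun u hu => key.2 u ((isWeakSolution_iff hT).1 hu)⟩

end Diamond

theorem hasTraceInequality_annular {d : ℕ} {Ω₁ Ω₂ : Set (EuclideanSpace ℝ (Fin d))}
    (hΩ₁ : IsBoundedC3Domain Ω₁) (hΩ₂ : IsBoundedC3Domain Ω₂) (hsub : closure Ω₁ ⊆ Ω₂) :
    HasTraceInequality (Ω₂ \ closure Ω₁) (frontier Ω₁) := by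
  obtain ⟨C, hC, h⟩ := exists_trace_le_annular hΩ₁ hΩ₂ hsub
  refine ⟨C + 1, by finiteness, fun φ hφ => le_mul_add_of_sq_le ?_⟩
  rw [eLpNorm_two_sq, eLpNorm_two_sq, eLpNorm_two_sq]
  exact h φ hφ

end RobinProblem

end

theorem theorem2p1 (d : ℕ) (hd : d = 2 ∨ d = 3)
    (Ω₁ Ω₂ Ω Γ Γ₀ : Set (EuclideanSpace ℝ (Fin d)))
    (hΩ₁ : RobinProblem.IsBoundedC3Domain Ω₁) (hΩ₂ : RobinProblem.IsBoundedC3Domain Ω₂)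
    (hsub : closure Ω₁ ⊆ Ω₂)
    (hΩ : Ω = Ω₂ \ closure Ω₁) (hΓ : Γ = frontier Ω₁) (hΓ₀ : Γ₀ = frontier Ω₂)
    (hconn : IsConnected Ω) :
    ∃ C : ℝ, 0 < C ∧
      ∀ β : ℝ → ℝ, ContDiff ℝ 3 β → Monotone β → β 0 = 0 →
        (∀ k : ℕ, 1 ≤ k → k ≤ 3 → ∃ M : ℝ, ∀ r : ℝ, |iteratedDeriv k β r| ≤ M) →
      ∀ a : EuclideanSpace ℝ (Fin d) → ℝ,
        MemLp a ⊤ (RobinProblem.surfaceMeasure Γ) →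
        (∃ a₀ : ℝ, 0 < a₀ ∧ ∀ᵐ x ∂(RobinProblem.surfaceMeasure Γ), a₀ ≤ a x) →
      ∀ (f : StrongDual ℝ (RobinProblem.H1 Ω)) (g : StrongDual ℝ (RobinProblem.HHalf Ω Γ)),
        (∃! u : RobinProblem.H1Diamond Ω Γ₀, RobinProblem.IsWeakSolution β a f g u) ∧
        ∀ u : RobinProblem.H1Diamond Ω Γ₀, RobinProblem.IsWeakSolution β a f g u →
          ‖u‖ ≤ C * (‖f‖ + ‖g‖) := by
  subst hΩ hΓ hΓ₀
  have hT := RobinProblem.hasTraceInequality_annular hΩ₁ hΩ₂ hsub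
  have hcoer := RobinProblem.Diamond.exists_coercive
    (RobinProblem.exists_poincare_annular (by omega) hΩ₁ hΩ₂ hsub hconn)
  -- The constant is the inverse coercivity constant, fixed by the Poincaré inequality before `β`,
  -- `a`, `f` and `g` are introduced.
  refine ⟨hcoer.choose⁻¹, inv_pos.2 hcoer.choose_spec.1, fun β hβ hmono β0 hbd a ha ha0 f g => ?_⟩
  have hK := (RobinProblem.exists_lipschitzWith_of_iteratedDeriv_bounded hβ
    (hbd 1 le_rfl (by norm_num))).choose_spec
  exact RobinProblem.Diamond.existsUnique_isWeakSolution hT hcoer.choose_spec.1 hcoer.choose_spec.2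
    hK β0 hmono ha (ha0.elim fun a₀ h => h.2.mono fun x hx => h.1.le.trans hx) f g
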